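/- Let $m\ge 1$, $n\ge 1$ be integers, $N=m+n$ and $0<s<1$. For $\alpha>0$ put $$C_\alpha=\{(y,z)\in\mathbb R^m\times\mathbb R^n : |z|=\alpha|y|\},\qquad E_\alpha=\{(y,z)\in\mathbb R^m\times\mathbb R^n : |z|>\alpha|y|\},$$ so that $C_\alpha=\partial E_\alpha$. For an open set $E\subset\mathbb R^N$ with boundary $\Sigma=\partial E$, the nonlocal mean curvature of $\Sigma$ at $p\in\Sigma$ is the principal value $$H^s_\Sigma(p)=\lim_{\delta\downarrow 0}\int_{\mathbb R^N\setminus B(p,\delta)}\frac{\chi_E(x)-\chi_{\mathbb R^N\setminus E}(x)}{|x-p|^{N+s}}\,dx .$$ A solid cone is a set $E=\{tx : t>0,\ x\in\mathcal O\}$ with $\mathcal O$ a relatively open subset of the unit sphere $S^{N-1}$. Its boundary $\Sigma=\partial E$ is called a nonlocal minimal cone if, near each of its points other than the origin, $\Sigma$ is a smooth hypersurface with $E$ on exactly one side of it, and $H^s_\Sigma(p)$ exists and equals $0$ for every $p\in\Sigma\setminus\{0\}$. Then there is exactly one $\alpha=\alpha(s,m,n)>0$ such that $C_\alpha=\partial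 E_\alpha$ is a nonlocal minimal cone. -/

import Mathlib

open MeasureTheory Set Filter Topology
open scoped ContDiff

noncomputable section

namespace NonlocalMinimal

section General

variable {V : Type*} [NormedAddCommGroup V] [InnerProductSpace ℝ V] [FiniteDimensional ℝ V]
  [MeasurableSpace V] [BorelSpace V]

/-- The integrand `(χ_E(x) - χ_{V \ E}(x)) / |x - p|^{N+s}` with `N = dim V`. -/
def curvatureIntegrand (s : ℝ) (E : Set V) (p x : V) : ℝ :=
  (E.indicator (fun _ => (1 : ℝ)) x - Eᶜ.indicator (fun _ => (1 : ℝ)) x) /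
    ‖x - p‖ ^ ((Module.finrank ℝ V : ℝ) + s)

/-- The nonlocal mean curvature of `∂E` at `p` exists as a principal value, and equals `h`:
the integral over the complement of the ball of radius `δ` about `p` converges absolutely for
every `δ > 0` and tends to `h` as `δ` decreases to `0`. -/
def HasNonlocalMeanCurvature (s : ℝ) (E : Set V) (p : V) (h : ℝ) : Prop :=
  (∀ δ : ℝ, 0 < δ → IntegrableOn (curvatureIntegrand s E p) (Metric.ball p δ)ᶜ volume) ∧
    Tendsto (fun δ : ℝ => ∫ x in (Metric.ball p δ)ᶜ, curvatureIntegrand s E p x)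
      (𝓝[>] 0) (𝓝 h)

/-- Near `p` the set `E` is the region on one side of a smooth hypersurface, its boundary. -/
def HasSmoothBoundaryAt (E : Set V) (p : V) : Prop :=
  ∃ (U : Set V) (f : V → ℝ), IsOpen U ∧ p ∈ U ∧ ContDiffOn ℝ ∞ f U ∧
    (∀ x ∈ U, fderiv ℝ f x ≠ 0) ∧ E ∩ U = {x ∈ U | 0 < f x} ∧
    frontier E ∩ U = {x ∈ U | f x = 0}

/-- `∂E` is a nonlocal minimal surface in `Ω`: it is regular there, and its nonlocal mean
curvature vanishes at each of its points in `Ω`. -/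
def IsNonlocalMinimalSurface (s : ℝ) (Ω E : Set V) : Prop :=
  ∀ p ∈ frontier E ∩ Ω, HasSmoothBoundaryAt E p ∧ HasNonlocalMeanCurvature s E p 0

/-- Solid cones `{t x | t > 0, x ∈ O}` over a relatively open subset `O` of the unit sphere. -/
def IsSolidCone (E : Set V) : Prop :=
  ∃ O : Set (Metric.sphere (0 : V) 1), IsOpen O ∧
    E = {v | ∃ t : ℝ, 0 < t ∧ ∃ x ∈ O, v = t • (x : V)}

/-- `∂E` is a nonlocal minimal cone: `E` is a solid cone, and `∂E` is a nonlocal minimal surface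
away from the vertex. -/
def IsNonlocalMinimalCone (s : ℝ) (E : Set V) : Prop :=
  IsSolidCone E ∧ IsNonlocalMinimalSurface s {0}ᶜ E

end General

/-- `ℝ^m × ℝ^n` with its Euclidean norm `|(y, z)|² = |y|² + |z|²`. -/
abbrev Space (m n : ℕ) : Type :=
  WithLp 2 (EuclideanSpace ℝ (Fin m) × EuclideanSpace ℝ (Fin n))

/-- `C_α = {(y, z) : |z| = α |y|}`. -/
def lawsonCone (m n : ℕ) (α : ℝ) : Set (Space m n) := {x | ‖x.snd‖ = α * ‖x.fst‖}

/-- `E_α = {(y, z) : |z| > α |y|}`. -/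
def solidLawsonCone (m n : ℕ) (α : ℝ) : Set (Space m n) := {x | α * ‖x.fst‖ < ‖x.snd‖}

end NonlocalMinimal

end

/-! Write α = tan θ with 0 < θ < π/2. Orthogonal maps of the two factors and dilations act
transitively on the boundary of the cone away from the vertex, so the curvature vanishes everywhere
once it vanishes at one point, and a single real equation in θ is left.

To compare different angles, each cone is moved rigidly so that the chosen boundary point is the
origin and the vertex is -e (`tiltedCone`). The moved cones are nested, decreasing in θ. Indeed,
with (|y|, |z|) = |x| (cos ω, sin ω), `coneFun θ x` is |x| sin(ω - θ), and a rotation by φ in the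
plane of e and f lowers ω by at most φ (`coneFun_le_coneFun_rotLin`). Hence the curvature is
strictly decreasing in θ (`curv_lt_curv`).

Averaging over x ↦ -x turns the principal value into `curv`, an absolutely convergent integral: the
even part of the sign vanishes on two tangent balls, and outside them the kernel is integrable
because s < 1. Balls common to all nearby θ give continuity by dominated convergence
(`tendsto_curv`). As θ tends to 0 or π/2 the even sign tends to 1 or -1. The balls used shrink to
nothing there, and nestedness replaces domination (`eventually_curv_pos`), so both signs of the
curvature occur. The intermediate value theorem gives a zero and strict monotonicity its uniqueness.
-/

noncomputable section

namespace NonlocalMinimal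

/-! ### Signs of sets and their even parts. -/

section Sign

variable {V : Type*}

/-- The function that is `1` on `A` and `-1` off `A`. -/
def sgn (A : Set V) (x : V) : ℝ :=
  A.indicator (fun _ => (1 : ℝ)) x - Aᶜ.indicator (fun _ => (1 : ℝ)) x

theorem sgn_of_mem {A : Set V} {x : V} (h : x ∈ A) : sgn A x = 1 := by simp [sgn, h]

theorem sgn_of_notMem {A : Set V} {x : V} (h : x ∉ A) : sgn A x = -1 := by simp [sgn, h]

theorem sgn_compl (A : Set V) (x : V) : sgn Aᶜ x = -sgn A x := by simp [sgn]

theorem abs_sgn (A : Set V) (x : V) : |sgn A x| = 1 := by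
  by_cases h : x ∈ A
  · simp [sgn_of_mem h]
  · simp [sgn_of_notMem h]

theorem sgn_le_one (A : Set V) (x : V) : sgn A x ≤ 1 := (le_abs_self _).trans (abs_sgn A x).le

theorem sgn_mono {A B : Set V} (h : A ⊆ B) (x : V) : sgn A x ≤ sgn B x := by
  by_cases hx : x ∈ B
  · rw [sgn_of_mem hx]; exact sgn_le_one A x
  · rw [sgn_of_notMem hx, sgn_of_notMem fun h' => hx (h h')]

theorem sgn_preimage {W : Type*} (f : V → W) (A : Set W) (x : V) :
    sgn (f ⁻¹' A) x = sgn A (f x) := by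
  by_cases h : f x ∈ A
  · rw [sgn_of_mem h, sgn_of_mem (show x ∈ f ⁻¹' A from h)]
  · rw [sgn_of_notMem h, sgn_of_notMem (show x ∉ f ⁻¹' A from h)]

theorem measurable_sgn [MeasurableSpace V] {A : Set V} (hA : MeasurableSet A) :
    Measurable (sgn A) :=
  (measurable_const.indicator hA).sub (measurable_const.indicator hA.compl)

/-- The even part of `sgn A`. -/
def evenSgn [Neg V] (A : Set V) (x : V) : ℝ := (sgn A x + sgn A (-x)) / 2

variable [AddGroup V]

theorem evenSgn_compl (A : Set V) (x : V) : evenSgn Aᶜ x = -evenSgn A x := by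
  simp only [evenSgn, sgn_compl]; ring

theorem abs_evenSgn_le (A : Set V) (x : V) : |evenSgn A x| ≤ 1 := by
  unfold evenSgn
  have h1 := abs_le.1 (abs_sgn A x).le
  have h2 := abs_le.1 (abs_sgn A (-x)).le
  rw [abs_le]; constructor <;> linarith

theorem evenSgn_mono {A B : Set V} (h : A ⊆ B) (x : V) : evenSgn A x ≤ evenSgn B x := by
  unfold evenSgn
  linarith [sgn_mono h x, sgn_mono h (-x)]

theorem measurable_evenSgn [MeasurableSpace V] [MeasurableNeg V] {A : Set V}
    (hA : MeasurableSet A) : Measurable (evenSgn A) :=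
  ((measurable_sgn hA).add ((measurable_sgn hA).comp measurable_neg)).div_const 2

end Sign

/-! ### The singular kernel and tangent balls. -/

section Kernel

variable {V : Type*} [NormedAddCommGroup V] [InnerProductSpace ℝ V]

/-- The kernel `|x|^{-(N+s)}` with `N = dim V`. -/
def kernel (s : ℝ) (x : V) : ℝ := (‖x‖ ^ ((Module.finrank ℝ V : ℝ) + s))⁻¹

theorem kernel_nonneg (s : ℝ) (x : V) : 0 ≤ kernel s x := by unfold kernel; positivity

theorem kernel_pos (s : ℝ) {x : V} (hx : x ≠ 0) : 0 < kernel s x := by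
  have := norm_pos_iff.2 hx
  unfold kernel; positivity

theorem kernel_neg (s : ℝ) (x : V) : kernel s (-x) = kernel s x := by simp [kernel]

/-- The singular point gets the default `0⁻¹ = 0`, which supplies the hypothesis `h0` of
`tendsto_setIntegral_compl_ball`. -/
theorem kernel_zero {s : ℝ} (hs0 : 0 < s) : kernel s (0 : V) = 0 := by
  rw [kernel, norm_zero, Real.zero_rpow (by positivity), inv_zero]

theorem measurable_kernel [MeasurableSpace V] [BorelSpace V] (s : ℝ) :
    Measurable (kernel s : V → ℝ) :=
  (measurable_norm.pow_const _).inv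

theorem curvatureIntegrand_eq [FiniteDimensional ℝ V] (s : ℝ) (E : Set V) (p x : V) :
    curvatureIntegrand s E p x = sgn E x * kernel s (x - p) := by
  simp [curvatureIntegrand, sgn, kernel, div_eq_mul_inv]

/-- `A` contains the ball of radius `ρ` tangent at the origin from the side of `ν`, and avoids the
opposite one. -/
def TangentBalls (ν : V) (ρ : ℝ) (A : Set V) : Prop :=
  Metric.ball (ρ • ν) ρ ⊆ A ∧ Metric.ball (-(ρ • ν)) ρ ⊆ Aᶜ

/-- The map x ↦ -x exchanges the two balls, so the signs at x and -x cancel. -/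
theorem TangentBalls.evenSgn_eq_zero {ν : V} {ρ : ℝ} {A : Set V} (h : TangentBalls ν ρ A) {x : V}
    (hx : x ∈ Metric.ball (ρ • ν) ρ ∪ Metric.ball (-(ρ • ν)) ρ) : evenSgn A x = 0 := by
  have key : ∀ c : V, x ∈ Metric.ball c ρ → -x ∈ Metric.ball (-c) ρ := by
    intro c hc
    rw [Metric.mem_ball] at hc ⊢
    rwa [dist_neg_neg]
  rcases hx with hx | hx
  · rw [evenSgn, sgn_of_mem (h.1 hx), sgn_of_notMem (h.2 (key _ hx))]; norm_num
  · have := key _ hx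
    rw [neg_neg] at this
    rw [evenSgn, sgn_of_mem (h.1 this), sgn_of_notMem (h.2 hx)]; norm_num

/-- The complement of the two tangent balls. -/
def tangentRegion (ν : V) (ρ : ℝ) : Set V :=
  (Metric.ball (ρ • ν) ρ ∪ Metric.ball (-(ρ • ν)) ρ)ᶜ

theorem measurableSet_tangentRegion [MeasurableSpace V] [BorelSpace V] (ν : V) (ρ : ℝ) :
    MeasurableSet (tangentRegion ν ρ) :=
  (measurableSet_ball.union measurableSet_ball).compl

theorem TangentBalls.norm_le {ν : V} {ρ : ℝ} {A : Set V} (h : TangentBalls ν ρ A) (s : ℝ) (x : V) :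
    ‖evenSgn A x * kernel s x‖ ≤ (tangentRegion ν ρ).indicator (kernel s) x := by
  by_cases hx : x ∈ tangentRegion ν ρ
  · rw [indicator_of_mem hx, norm_mul, Real.norm_of_nonneg (kernel_nonneg s x)]
    exact mul_le_of_le_one_left (kernel_nonneg s x) (abs_evenSgn_le A x)
  · rw [indicator_of_notMem hx, h.evenSgn_eq_zero (not_not.1 hx)]; simp

end Kernel

/-! ### Integrability of the kernel off the tangent balls. -/

section General

variable {V : Type*} [NormedAddCommGroup V] [InnerProductSpace ℝ V] [FiniteDimensional ℝ V]
  [MeasurableSpace V] [BorelSpace V]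

/-- Off the ball 1 + |x| ≤ (1 + δ⁻¹)|x|, and the exponent N + s exceeds the dimension. -/
theorem integrableOn_kernel_compl_ball {s : ℝ} (hs : 0 < s) {δ : ℝ} (hδ : 0 < δ) :
    IntegrableOn (kernel s : V → ℝ) (Metric.ball 0 δ)ᶜ := by
  have hq : (Module.finrank ℝ V : ℝ) < (Module.finrank ℝ V : ℝ) + s := by linarith
  have hq0 : 0 ≤ (Module.finrank ℝ V : ℝ) + s := by positivity
  have h := (integrable_one_add_norm (E := V) (μ := volume) hq).const_mul
    ((1 + δ⁻¹) ^ ((Module.finrank ℝ V : ℝ) + s))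
  refine Integrable.mono' h.integrableOn (measurable_kernel s).aestronglyMeasurable ?_
  refine (ae_restrict_iff' Metric.isOpen_ball.measurableSet.compl).2 (ae_of_all _ fun x hx => ?_)
  have hx' : δ ≤ ‖x‖ := by simpa using hx
  have hx0 : 0 < ‖x‖ := hδ.trans_le hx'
  rw [Real.norm_of_nonneg (kernel_nonneg s x), kernel, Real.rpow_neg (by positivity),
    ← div_eq_mul_inv, ← Real.div_rpow (by positivity) (by positivity),
    ← Real.inv_rpow (by positivity)]
  refine Real.rpow_le_rpow (by positivity) ?_ hq0
  rw [le_div_iff₀ (by positivity), mul_add, mul_one, inv_mul_cancel₀ hx0.ne']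
  have : ‖x‖⁻¹ ≤ δ⁻¹ := inv_anti₀ hδ hx'
  linarith

-- Splitting along ν and its orthogonal complement encloses the slab in a product of balls of
-- dimensions 1 and N - 1.
open scoped InnerProductSpace in
theorem exists_volume_slab_le {ν : V} (hν : ‖ν‖ = 1) :
    ∃ C : ENNReal, C ≠ ⊤ ∧ ∀ a r : ℝ, 0 ≤ a → 0 ≤ r →
      volume {x : V | |⟪ν, x⟫_ℝ| ≤ a ∧ ‖x‖ ≤ r} ≤
        C * ENNReal.ofReal (a * r ^ (Module.finrank ℝ V - 1)) := by
  have hν0 : ν ≠ 0 := by rintro rfl; simp at hν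
  set K : Submodule ℝ V := ℝ ∙ ν
  have hK1 : Module.finrank ℝ K = 1 := finrank_span_singleton hν0
  have hK2 : Module.finrank ℝ Kᗮ = Module.finrank ℝ V - 1 := by
    have := K.finrank_add_finrank_orthogonal; omega
  refine ⟨volume (Metric.closedBall (0 : K) 1) * volume (Metric.closedBall (0 : Kᗮ) 1),
    ENNReal.mul_ne_top measure_closedBall_lt_top.ne measure_closedBall_lt_top.ne, ?_⟩
  intro a r ha hr
  have hmp : MeasurePreserving (fun x : V => WithLp.ofLp (K.orthogonalDecomposition x)) :=
    (WithLp.volume_preserving_ofLp K Kᗮ).comp K.orthogonalDecomposition.measurePreserving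
  have hsub : {x : V | |⟪ν, x⟫_ℝ| ≤ a ∧ ‖x‖ ≤ r} ⊆
      (fun x : V => WithLp.ofLp (K.orthogonalDecomposition x)) ⁻¹'
        (Metric.closedBall (0 : K) a ×ˢ Metric.closedBall (0 : Kᗮ) r) := by
    rintro x ⟨h1, h2⟩
    simp only [mem_preimage, mem_prod, mem_closedBall_zero_iff,
      Submodule.orthogonalDecomposition_apply]
    refine ⟨?_, (Submodule.norm_orthogonalProjectionOnto_apply_le _ _).trans h2⟩
    rw [← Submodule.norm_coe, Submodule.coe_orthogonalProjectionOnto_apply,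
      show K.starProjection x = _ from Submodule.starProjection_unit_singleton ℝ hν x, norm_smul,
      hν, mul_one]
    exact h1
  refine (measure_mono hsub).trans ?_
  rw [hmp.measure_preimage
    (measurableSet_closedBall.prod measurableSet_closedBall).nullMeasurableSet,
    Measure.volume_eq_prod, Measure.prod_prod, Measure.addHaar_closedBall' _ _ ha,
    Measure.addHaar_closedBall' _ _ hr, hK1, hK2, pow_one, ENNReal.ofReal_mul ha]
  apply le_of_eq; ring

open scoped InnerProductSpace in
theorem integrableOn_kernel_closedBall_inter {s : ℝ} (hs0 : 0 < s) (hs1 : s < 1) {ν : V}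
    (hν : ‖ν‖ = 1) {c : ℝ} (hc : 0 < c) :
    IntegrableOn (kernel s) ({x : V | |⟪ν, x⟫_ℝ| ≤ c * ‖x‖ ^ 2} ∩ Metric.closedBall 0 1) := by
  obtain ⟨C, hC, hvol⟩ := exists_volume_slab_le hν
  set N := Module.finrank ℝ V with hN
  have hN1 : 1 ≤ N := by
    have : Nontrivial V := ⟨ν, 0, by rintro rfl; simp at hν⟩
    exact Module.finrank_pos
  refine ⟨(measurable_kernel s).aestronglyMeasurable, ?_⟩
  let S : ℕ → Set V := fun k =>
    {x : V | |⟪ν, x⟫_ℝ| ≤ c * ‖x‖ ^ 2} ∩ {x | (2⁻¹ : ℝ) ^ (k + 1) ≤ ‖x‖ ∧ ‖x‖ ≤ (2⁻¹ : ℝ) ^ k}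
  have hcover : {x : V | |⟪ν, x⟫_ℝ| ≤ c * ‖x‖ ^ 2} ∩ Metric.closedBall 0 1 ⊆
      {0} ∪ ⋃ k, S k := by
    rintro x ⟨hx, hx1⟩
    rw [mem_closedBall_zero_iff] at hx1
    by_cases h0 : x = 0
    · exact Or.inl h0
    · right
      obtain ⟨k, hk1, hk2⟩ := exists_nat_pow_near_of_lt_one (norm_pos_iff.2 h0) hx1
        (by norm_num : (0 : ℝ) < 2⁻¹) (by norm_num)
      exact mem_iUnion.2 ⟨k, hx, hk1.le, hk2⟩
  -- On the k-th dyadic shell the kernel is at most 2^((k+1)(N+s)) and the volume is at most C c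
  -- 2^(-2k) 2^(-k(N-1)). The product decays with ratio 2^(-(1-s)), which is where s < 1 enters.
  have hterm : ∀ k, ∫⁻ x in S k, ‖kernel s x‖ₑ ≤
      ENNReal.ofReal (2 ^ ((N : ℝ) + s) * c) * C * ENNReal.ofReal ((2⁻¹ : ℝ) ^ (1 - s)) ^ k := by
    intro k
    have hb : ∀ x ∈ S k, ‖kernel s x‖ₑ ≤ ENNReal.ofReal (((2⁻¹ : ℝ) ^ (k + 1)) ^ (-((N : ℝ) + s))) := by
      rintro x ⟨-, hx, -⟩
      rw [Real.enorm_of_nonneg (kernel_nonneg s x)]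
      apply ENNReal.ofReal_le_ofReal
      rw [kernel, Real.rpow_neg (by positivity)]
      exact inv_anti₀ (by positivity) (Real.rpow_le_rpow (by positivity) hx (by positivity))
    have hv : volume (S k) ≤ C * ENNReal.ofReal (c * ((2⁻¹ : ℝ) ^ k) ^ 2 * ((2⁻¹ : ℝ) ^ k) ^ (N - 1)) := by
      refine (measure_mono ?_).trans (hvol _ _ (by positivity) (by positivity))
      rintro x ⟨hx, -, hx2⟩
      exact ⟨hx.trans (by gcongr), hx2⟩
    have hmeas : MeasurableSet (S k) := by
      have c1 : IsClosed {x : V | |⟪ν, x⟫_ℝ| ≤ c * ‖x‖ ^ 2} :=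
        isClosed_le (by fun_prop) (by fun_prop)
      have c2 : IsClosed {x : V | (2⁻¹ : ℝ) ^ (k + 1) ≤ ‖x‖ ∧ ‖x‖ ≤ (2⁻¹ : ℝ) ^ k} :=
        (isClosed_le continuous_const continuous_norm).inter
          (isClosed_le continuous_norm continuous_const)
      exact (c1.inter c2).measurableSet
    calc ∫⁻ x in S k, ‖kernel s x‖ₑ
        ≤ ∫⁻ x in S k, ENNReal.ofReal (((2⁻¹ : ℝ) ^ (k + 1)) ^ (-((N : ℝ) + s))) :=
          setLIntegral_mono' hmeas hb
      _ = ENNReal.ofReal (((2⁻¹ : ℝ) ^ (k + 1)) ^ (-((N : ℝ) + s))) * volume (S k) := by simp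
      _ ≤ _ := mul_le_mul_right hv _
      _ = _ := by
        rw [mul_left_comm, ← ENNReal.ofReal_mul (by positivity), mul_right_comm (ENNReal.ofReal _),
          ← ENNReal.ofReal_pow (by positivity), ← ENNReal.ofReal_mul (by positivity), mul_comm C]
        congr 2
        have h2 : (0 : ℝ) < 2⁻¹ := by norm_num
        have e2 : (2 : ℝ) ^ ((N : ℝ) + s) = (2⁻¹ : ℝ) ^ (-((N : ℝ) + s)) := by
          rw [Real.inv_rpow (by norm_num), Real.rpow_neg (by norm_num), inv_inv]
        rw [e2, mul_assoc c, mul_left_comm, mul_comm _ c, mul_assoc]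
        congr 1
        simp only [← Real.rpow_natCast, ← Real.rpow_mul h2.le, ← Real.rpow_add h2]
        congr 1
        push_cast [hN1]
        ring
  refine lt_of_le_of_lt (lintegral_mono_set hcover) ?_
  refine lt_of_le_of_lt (lintegral_union_le _ _ _) ?_
  refine ENNReal.add_lt_top.2 ⟨?_, ?_⟩
  · have : Nontrivial V := ⟨ν, 0, by rintro rfl; simp at hν⟩
    rw [setLIntegral_measure_zero _ _ (measure_singleton 0)]
    exact ENNReal.zero_lt_top
  refine lt_of_le_of_lt (lintegral_iUnion_le _ _) ?_
  refine lt_of_le_of_lt (ENNReal.tsum_le_tsum hterm) ?_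
  rw [ENNReal.tsum_mul_left, ENNReal.tsum_geometric]
  refine ENNReal.mul_lt_top (ENNReal.mul_lt_top ENNReal.ofReal_lt_top hC.lt_top) ?_
  rw [ENNReal.inv_lt_top, tsub_pos_iff_lt]
  rw [ENNReal.ofReal_lt_one]
  exact Real.rpow_lt_one (by norm_num) (by norm_num) (by linarith)

-- Expanding |x ± ρν|² ≥ ρ² shows that a point outside both balls satisfies 2ρ|⟪ν, x⟫| ≤ |x|², which
-- places it in the thin region already treated or outside the unit ball.
open scoped InnerProductSpace in
theorem integrableOn_kernel_tangentRegion {s : ℝ} (hs0 : 0 < s) (hs1 : s < 1) {ν : V}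
    (hν : ‖ν‖ = 1) {ρ : ℝ} (hρ : 0 < ρ) : IntegrableOn (kernel s) (tangentRegion ν ρ) := by
  have h := (integrableOn_kernel_closedBall_inter hs0 hs1 hν (c := (2 * ρ)⁻¹)
    (by positivity)).union (integrableOn_kernel_compl_ball (V := V) hs0 one_pos)
  refine h.mono_set ?_
  intro x hx
  by_cases h1 : x ∈ Metric.ball (0 : V) 1
  swap
  · exact Or.inr h1
  refine Or.inl ⟨?_, Metric.ball_subset_closedBall h1⟩
  simp only [tangentRegion, mem_compl_iff, mem_union, Metric.mem_ball, not_or, not_lt,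
    dist_eq_norm, sub_neg_eq_add] at hx
  have e1 := norm_sub_sq_real x (ρ • ν)
  have e2 := norm_add_sq_real x (ρ • ν)
  rw [real_inner_smul_right, norm_smul, hν, mul_one, Real.norm_of_nonneg hρ.le,
    real_inner_comm] at e1 e2
  have h1 := pow_le_pow_left₀ hρ.le hx.1 2
  have h2 := pow_le_pow_left₀ hρ.le hx.2 2
  rw [mem_ofPred_eq, inv_mul_eq_div, le_div_iff₀ (by positivity), ← abs_of_pos (a := 2 * ρ)
    (by positivity), ← abs_mul, abs_le]
  constructor <;> nlinarith

/-! ### The principal value as an absolutely convergent integral: comparison and limits. -/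

/-- The regularised principal value at the origin. -/
def curv (s : ℝ) (A : Set V) : ℝ := ∫ x, evenSgn A x * kernel s x

theorem curv_compl (s : ℝ) (A : Set V) : curv s Aᶜ = -curv s A := by
  simp only [curv, evenSgn_compl, neg_mul, integral_neg]

theorem TangentBalls.integrable {s : ℝ} (hs0 : 0 < s) (hs1 : s < 1) {ν : V} (hν : ‖ν‖ = 1) {ρ : ℝ}
    (hρ : 0 < ρ) {A : Set V} (hA : MeasurableSet A) (h : TangentBalls ν ρ A) :
    Integrable (fun x => evenSgn A x * kernel s x) :=
  ((integrable_indicator_iff (measurableSet_tangentRegion ν ρ)).2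
    (integrableOn_kernel_tangentRegion hs0 hs1 hν hρ)).mono'
    ((measurable_evenSgn hA).mul (measurable_kernel s)).aestronglyMeasurable
    (ae_of_all _ (h.norm_le s))

theorem integrableOn_sgn_mul_kernel {s : ℝ} (hs0 : 0 < s) {A : Set V} (hA : MeasurableSet A)
    {δ : ℝ} (hδ : 0 < δ) : IntegrableOn (fun x => sgn A x * kernel s x) (Metric.ball 0 δ)ᶜ :=
  (integrableOn_kernel_compl_ball hs0 hδ).mono'
    ((measurable_sgn hA).mul (measurable_kernel s)).aestronglyMeasurable
    (ae_of_all _ fun x => by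
      rw [norm_mul, Real.norm_of_nonneg (kernel_nonneg s x), Real.norm_eq_abs, abs_sgn, one_mul])

/-- The domain and the kernel are invariant under x ↦ -x, so only the even part contributes. -/
theorem setIntegral_sgn_mul_kernel {s : ℝ} (hs0 : 0 < s) {A : Set V} (hA : MeasurableSet A)
    {δ : ℝ} (hδ : 0 < δ) : ∫ x in (Metric.ball 0 δ)ᶜ, sgn A x * kernel s x =
      ∫ x in (Metric.ball 0 δ)ᶜ, evenSgn A x * kernel s x := by
  have hpre : (fun x : V => -x) ⁻¹' (Metric.ball 0 δ)ᶜ = (Metric.ball 0 δ)ᶜ := by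
    ext x; simp
  have hmp : MeasurePreserving (fun x : V => -x) := Measure.measurePreserving_neg volume
  have hemb : MeasurableEmbedding (fun x : V => -x) := (MeasurableEquiv.neg V).measurableEmbedding
  have h1 := integrableOn_sgn_mul_kernel hs0 hA hδ
  have hneg : ∫ x in (Metric.ball 0 δ)ᶜ, sgn A (-x) * kernel s x =
      ∫ x in (Metric.ball 0 δ)ᶜ, sgn A x * kernel s x := by
    have := hmp.setIntegral_preimage_emb hemb (fun x => sgn A x * kernel s x) (Metric.ball 0 δ)ᶜ
    rw [hpre] at this
    simpa only [kernel_neg] using this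
  have h2 : IntegrableOn (fun x => sgn A (-x) * kernel s x) (Metric.ball 0 δ)ᶜ := by
    have := (hmp.integrableOn_comp_preimage hemb).2 h1
    rw [hpre] at this
    simpa only [Function.comp_def, kernel_neg] using this
  have : ∀ x, evenSgn A x * kernel s x =
      (1 / 2) * (sgn A x * kernel s x) + (1 / 2) * (sgn A (-x) * kernel s x) := by
    intro x; rw [evenSgn]; ring
  simp only [this]
  rw [integral_add (h1.const_mul _) (h2.const_mul _), integral_const_mul, integral_const_mul, hneg]
  ring

/-- Every truncation with δ > 0 vanishes at the origin, so pointwise convergence there needs `f 0 =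
0`; the space may be trivial, so {0} cannot be discarded as a null set. -/
theorem tendsto_setIntegral_compl_ball {f : V → ℝ} (hf : Integrable f) (h0 : f 0 = 0) :
    Tendsto (fun δ : ℝ => ∫ x in (Metric.ball (0 : V) δ)ᶜ, f x) (𝓝[>] 0) (𝓝 (∫ x, f x)) := by
  simp only [← integral_indicator (measurableSet_ball.compl : MeasurableSet (Metric.ball (0 : V) _)ᶜ)]
  refine tendsto_integral_filter_of_dominated_convergence (fun x => ‖f x‖) ?_ ?_ hf.norm ?_
  · exact Eventually.of_forall fun δ => hf.1.indicator measurableSet_ball.compl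
  · exact Eventually.of_forall fun δ => ae_of_all _ fun x => norm_indicator_le_norm_self _ _
  · refine ae_of_all _ fun x => ?_
    by_cases hx : x = 0
    · subst hx
      have : ∀ δ : ℝ, (Metric.ball (0 : V) δ)ᶜ.indicator f 0 = f 0 := by
        intro δ; by_cases h : (0 : V) ∈ (Metric.ball (0 : V) δ)ᶜ
        · rw [indicator_of_mem h]
        · rw [indicator_of_notMem h, h0]
      simp only [this]; exact tendsto_const_nhds
    · refine tendsto_const_nhds.congr' ?_
      have : Ioo (0 : ℝ) ‖x‖ ∈ 𝓝[>] 0 := Ioo_mem_nhdsGT (norm_pos_iff.2 hx)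
      filter_upwards [this] with δ hδ
      rw [indicator_of_mem]
      simpa using hδ.2.le

theorem TangentBalls.hasNonlocalMeanCurvature_iff {s : ℝ} (hs0 : 0 < s) (hs1 : s < 1) {ν : V}
    (hν : ‖ν‖ = 1) {ρ : ℝ} (hρ : 0 < ρ) {A : Set V} (hA : MeasurableSet A)
    (h : TangentBalls ν ρ A) {c : ℝ} : HasNonlocalMeanCurvature s A 0 c ↔ curv s A = c := by
  have hi := h.integrable hs0 hs1 hν hρ hA
  have ht := tendsto_setIntegral_compl_ball hi (by rw [kernel_zero hs0, mul_zero])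
  have ht' : Tendsto (fun δ : ℝ => ∫ x in (Metric.ball (0 : V) δ)ᶜ, curvatureIntegrand s A 0 x)
      (𝓝[>] 0) (𝓝 (curv s A)) := by
    refine ht.congr' ?_
    filter_upwards [self_mem_nhdsWithin] with δ hδ
    simp only [curvatureIntegrand_eq, sub_zero]
    exact (setIntegral_sgn_mul_kernel hs0 hA hδ).symm
  refine ⟨fun hc => tendsto_nhds_unique ht' hc.2, ?_⟩
  rintro rfl
  refine ⟨fun δ hδ => (integrableOn_sgn_mul_kernel hs0 hA hδ).congr_fun (fun x _ => ?_)
    measurableSet_ball.compl, ht'⟩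
  simp only [curvatureIntegrand_eq, sub_zero]

/-- On B \ A the sign jumps from -1 to 1 while the sign at -x does not drop, so the even part gains
at least 1 on a set of positive measure. The kernel is positive there because `h0` excludes the
origin. -/
theorem curv_lt_curv {s : ℝ} {A B : Set V}
    (hA : Integrable fun x => evenSgn A x * kernel s x)
    (hB : Integrable fun x => evenSgn B x * kernel s x) (hAB : A ⊆ B) {x₀ : V}
    (hx₀ : B \ A ∈ 𝓝 x₀) (h0 : (0 : V) ∉ B \ A) : curv s A < curv s B := by
  rw [← sub_pos, curv, curv, ← integral_sub hB hA]
  have hnn : ∀ x, 0 ≤ evenSgn B x * kernel s x - evenSgn A x * kernel s x := fun x =>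
    sub_nonneg.2 (mul_le_mul_of_nonneg_right (evenSgn_mono hAB x) (kernel_nonneg s x))
  rw [integral_pos_iff_support_of_nonneg hnn (hB.sub hA)]
  refine (Measure.measure_pos_of_mem_nhds volume hx₀).trans_le (measure_mono ?_)
  rintro x ⟨hxB, hxA⟩
  have hx : x ≠ 0 := by rintro rfl; exact h0 ⟨hxB, hxA⟩
  have h1 : evenSgn A x + 1 ≤ evenSgn B x := by
    rw [evenSgn, evenSgn, sgn_of_mem hxB, sgn_of_notMem hxA]
    linarith [sgn_mono hAB (-x)]
  rw [Function.mem_support, ← sub_mul]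
  exact (mul_pos (by linarith) (kernel_pos s hx)).ne'

/-- One pair of tangent balls shared by all the sets gives a common dominating function. -/
theorem tendsto_curv {ι : Type*} {l : Filter ι} [l.IsCountablyGenerated] {s : ℝ} (hs0 : 0 < s)
    (hs1 : s < 1) {ν : V} (hν : ‖ν‖ = 1) {ρ : ℝ} (hρ : 0 < ρ) {A : ι → Set V} {B : Set V}
    (hA : ∀ i, MeasurableSet (A i)) (hT : ∀ᶠ i in l, TangentBalls ν ρ (A i))
    (hlim : ∀ᵐ x : V, Tendsto (fun i => evenSgn (A i) x) l (𝓝 (evenSgn B x))) :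
    Tendsto (fun i => curv s (A i)) l (𝓝 (curv s B)) := by
  refine tendsto_integral_filter_of_dominated_convergence
    ((tangentRegion ν ρ).indicator (kernel s)) ?_ ?_ ?_ ?_
  · exact Eventually.of_forall fun i =>
      ((measurable_evenSgn (hA i)).mul (measurable_kernel s)).aestronglyMeasurable
  · exact hT.mono fun i hi => ae_of_all _ (hi.norm_le s)
  · exact (integrable_indicator_iff (measurableSet_tangentRegion ν ρ)).2
      (integrableOn_kernel_tangentRegion hs0 hs1 hν hρ)
  · exact hlim.mono fun x hx => hx.mul_const _

/-- No tangent balls are shared here, so near the origin nothing dominates the integrand; the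
inclusion B ⊆ A i bounds that contribution below by the one of B. -/
theorem eventually_curv_pos [Nontrivial V] {ι : Type*} {l : Filter ι} [l.IsCountablyGenerated]
    {s : ℝ} (hs0 : 0 < s) {A : ι → Set V} {B : Set V} (hA : ∀ i, MeasurableSet (A i))
    (hAi : ∀ᶠ i in l, Integrable fun x => evenSgn (A i) x * kernel s x)
    (hBi : Integrable fun x => evenSgn B x * kernel s x) (hBA : ∀ᶠ i in l, B ⊆ A i)
    (hlim : ∀ᵐ x : V, Tendsto (fun i => evenSgn (A i) x) l (𝓝 1)) :
    ∀ᶠ i in l, 0 < curv s (A i) := by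
  have hK := fun {δ : ℝ} (hδ : 0 < δ) => integrableOn_kernel_compl_ball (V := V) hs0 hδ
  set κ : ℝ := ∫ x in (Metric.ball (0 : V) 1)ᶜ, kernel s x with hκ
  have hκ0 : 0 < κ := by
    rw [hκ, setIntegral_pos_iff_support_of_nonneg_ae (ae_of_all _ (kernel_nonneg s)) (hK one_pos)]
    obtain ⟨v, hv⟩ := exists_ne (0 : V)
    have hnhds : (Metric.closedBall (0 : V) 1)ᶜ ∈ 𝓝 ((2 / ‖v‖) • v) := by
      refine Metric.isClosed_closedBall.isOpen_compl.mem_nhds ?_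
      have := norm_pos_iff.2 hv
      simp [norm_smul, this.ne']
    refine (Measure.measure_pos_of_mem_nhds volume hnhds).trans_le (measure_mono fun x hx => ?_)
    refine ⟨(kernel_pos s ?_).ne', fun h => hx (Metric.ball_subset_closedBall h)⟩
    rintro rfl
    simp at hx
  have ht := tendsto_setIntegral_compl_ball hBi (by rw [kernel_zero hs0, mul_zero])
  -- The radius makes the part of `curv s B` inside the ball exceed -κ/2. Since δ < 1, the kernel
  -- mass outside the ball is still at least κ, so it outweighs this loss.
  obtain ⟨δ, hδ, hδ0, hδ1⟩ : ∃ δ : ℝ,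
      ∫ x in (Metric.ball (0 : V) δ)ᶜ, evenSgn B x * kernel s x < curv s B + κ / 2 ∧ 0 < δ ∧
        δ < 1 := by
    have h1 := ht.eventually_lt_const (show curv s B < curv s B + κ / 2 by linarith)
    have h2 : Ioo (0 : ℝ) 1 ∈ 𝓝[>] 0 := Ioo_mem_nhdsGT one_pos
    obtain ⟨δ, h1, h2⟩ := (h1.and h2).exists
    exact ⟨δ, h1, h2.1, h2.2⟩
  have hκδ : κ ≤ ∫ x in (Metric.ball (0 : V) δ)ᶜ, kernel s x :=
    setIntegral_mono_set (hK hδ0) (ae_of_all _ (kernel_nonneg s))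
      (compl_subset_compl.2 (Metric.ball_subset_ball hδ1.le)).eventuallyLE
  have hlimδ : Tendsto (fun i => ∫ x in (Metric.ball (0 : V) δ)ᶜ, evenSgn (A i) x * kernel s x) l
      (𝓝 (∫ x in (Metric.ball (0 : V) δ)ᶜ, kernel s x)) := by
    refine tendsto_integral_filter_of_dominated_convergence (kernel s) ?_ ?_ (hK hδ0) ?_
    · exact Eventually.of_forall fun i =>
        ((measurable_evenSgn (hA i)).mul (measurable_kernel s)).aestronglyMeasurable
    · refine Eventually.of_forall fun i => ae_of_all _ fun x => ?_
      rw [norm_mul, Real.norm_of_nonneg (kernel_nonneg s x)]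
      exact mul_le_of_le_one_left (kernel_nonneg s x) (abs_evenSgn_le _ x)
    · refine ae_restrict_of_ae (hlim.mono fun x hx => ?_)
      simpa using hx.mul_const (kernel s x)
  filter_upwards [hAi, hBA, hlimδ.eventually_const_lt
    (show κ / 2 < ∫ x in (Metric.ball (0 : V) δ)ᶜ, kernel s x by linarith)] with i hi hsub hi'
  have hmono : ∫ x in (Metric.ball (0 : V) δ)ᶜ,
      (evenSgn (A i) x * kernel s x - evenSgn B x * kernel s x) ≤
      ∫ x, (evenSgn (A i) x * kernel s x - evenSgn B x * kernel s x) :=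
    setIntegral_le_integral (hi.sub hBi) (ae_of_all _ fun x =>
      sub_nonneg.2 (mul_le_mul_of_nonneg_right (evenSgn_mono hsub x) (kernel_nonneg s x)))
  rw [integral_sub hi.integrableOn hBi.integrableOn, integral_sub hi hBi] at hmono
  change _ ≤ curv s (A i) - curv s B at hmono
  linarith

end General

/-! ### Rotated cones: nestedness, tangent balls and dependence on the angle. -/

section Cone

open scoped InnerProductSpace

variable {Y Z : Type*} [NormedAddCommGroup Y] [NormedAddCommGroup Z]

/-- The function whose positivity set is the cone `|z| > tan θ |y|`; it is the signed distance to
the boundary near the boundary. -/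
def coneFun (θ : ℝ) (x : WithLp 2 (Y × Z)) : ℝ := Real.cos θ * ‖x.snd‖ - Real.sin θ * ‖x.fst‖

theorem coneFun_zero (x : WithLp 2 (Y × Z)) : coneFun 0 x = ‖x.snd‖ := by simp [coneFun]

theorem coneFun_pi_div_two (x : WithLp 2 (Y × Z)) : coneFun (Real.pi / 2) x = -‖x.fst‖ := by
  simp [coneFun]

theorem continuous_coneFun : Continuous fun q : ℝ × WithLp 2 (Y × Z) => coneFun q.1 q.2 := by
  unfold coneFun
  fun_prop

/-- The map x ↦ (|y|, |z|) is 1-Lipschitz, and `coneFun` pairs it with the unit vector (-sin θ, cos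
θ). -/
theorem abs_coneFun_sub_le (θ : ℝ) (x x' : WithLp 2 (Y × Z)) :
    |coneFun θ x - coneFun θ x'| ≤ dist x x' := by
  rw [dist_eq_norm]
  have h := WithLp.prod_norm_sq_eq_of_L2 (x - x')
  have h1 := abs_norm_sub_norm_le x.fst x'.fst
  have h2 := abs_norm_sub_norm_le x.snd x'.snd
  rw [← WithLp.sub_fst] at h1
  rw [← WithLp.sub_snd] at h2
  have q1 := sq_le_sq' (by linarith [abs_nonneg (‖x.fst‖ - ‖x'.fst‖), norm_nonneg (x - x').fst]) h1
  have q2 := sq_le_sq' (by linarith [abs_nonneg (‖x.snd‖ - ‖x'.snd‖), norm_nonneg (x - x').snd]) h2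
  rw [sq_abs] at q1 q2
  refine abs_le_of_sq_le_sq ?_ (norm_nonneg _)
  rw [h]
  have e : coneFun θ x - coneFun θ x' =
      Real.cos θ * (‖x.snd‖ - ‖x'.snd‖) - Real.sin θ * (‖x.fst‖ - ‖x'.fst‖) := by
    simp only [coneFun]; ring
  rw [e]
  generalize ‖x.snd‖ - ‖x'.snd‖ = a at *
  generalize ‖x.fst‖ - ‖x'.fst‖ = b at *
  have : (Real.cos θ * a - Real.sin θ * b) ^ 2 + (Real.cos θ * b + Real.sin θ * a) ^ 2 =
      b ^ 2 + a ^ 2 := by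
    linear_combination (a ^ 2 + b ^ 2) * Real.sin_sq_add_cos_sq θ
  linarith [sq_nonneg (Real.cos θ * b + Real.sin θ * a)]

variable [InnerProductSpace ℝ Y] [InnerProductSpace ℝ Z]

/-- Rotation by `θ` in the plane spanned by unit vectors `e` and `f`, as a linear map. -/
def rotLin (e : Y) (f : Z) (θ : ℝ) : WithLp 2 (Y × Z) →ₗ[ℝ] WithLp 2 (Y × Z) where
  toFun x := WithLp.toLp 2
    (x.fst + ((Real.cos θ - 1) * ⟪e, x.fst⟫_ℝ - Real.sin θ * ⟪f, x.snd⟫_ℝ) • e,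
      x.snd + (Real.sin θ * ⟪e, x.fst⟫_ℝ + (Real.cos θ - 1) * ⟪f, x.snd⟫_ℝ) • f)
  map_add' x x' := by
    refine (WithLp.ofLp_injective 2) (Prod.ext ?_ ?_) <;>
    simp only [WithLp.add_fst, WithLp.add_snd, inner_add_right, WithLp.ofLp_add, Prod.fst_add,
      Prod.snd_add] <;>
    module
  map_smul' c x := by
    refine (WithLp.ofLp_injective 2) (Prod.ext ?_ ?_) <;>
    simp only [WithLp.smul_fst, WithLp.smul_snd, inner_smul_right, RingHom.id_apply,
      WithLp.ofLp_smul, Prod.smul_fst, Prod.smul_snd] <;>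
    module

theorem rotLin_fst (e : Y) (f : Z) (θ : ℝ) (x : WithLp 2 (Y × Z)) : (rotLin e f θ x).fst =
    x.fst + ((Real.cos θ - 1) * ⟪e, x.fst⟫_ℝ - Real.sin θ * ⟪f, x.snd⟫_ℝ) • e := rfl

theorem rotLin_snd (e : Y) (f : Z) (θ : ℝ) (x : WithLp 2 (Y × Z)) : (rotLin e f θ x).snd =
    x.snd + (Real.sin θ * ⟪e, x.fst⟫_ℝ + (Real.cos θ - 1) * ⟪f, x.snd⟫_ℝ) • f := rfl

theorem continuous_rotLin (e : Y) (f : Z) (x : WithLp 2 (Y × Z)) :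
    Continuous fun θ => rotLin e f θ x := by
  refine (WithLp.prod_continuous_toLp 2 Y Z).comp ?_
  fun_prop

variable {e : Y} {f : Z}

theorem rotLin_fst_norm_sq (he : ‖e‖ = 1) (θ : ℝ) (x : WithLp 2 (Y × Z)) :
    ‖(rotLin e f θ x).fst‖ ^ 2 = ‖x.fst‖ ^ 2 - ⟪e, x.fst⟫_ℝ ^ 2 +
      (Real.cos θ * ⟪e, x.fst⟫_ℝ - Real.sin θ * ⟪f, x.snd⟫_ℝ) ^ 2 := by
  rw [rotLin_fst, norm_add_sq_real, norm_smul, he, real_inner_smul_right, real_inner_comm e,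
    mul_one, Real.norm_eq_abs, sq_abs]
  ring

theorem rotLin_snd_norm_sq (hf : ‖f‖ = 1) (θ : ℝ) (x : WithLp 2 (Y × Z)) :
    ‖(rotLin e f θ x).snd‖ ^ 2 = ‖x.snd‖ ^ 2 - ⟪f, x.snd⟫_ℝ ^ 2 +
      (Real.sin θ * ⟪e, x.fst⟫_ℝ + Real.cos θ * ⟪f, x.snd⟫_ℝ) ^ 2 := by
  rw [rotLin_snd, norm_add_sq_real, norm_smul, hf, real_inner_smul_right, real_inner_comm f,
    mul_one, Real.norm_eq_abs, sq_abs]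
  ring

theorem norm_rotLin (he : ‖e‖ = 1) (hf : ‖f‖ = 1) (θ : ℝ) (x : WithLp 2 (Y × Z)) :
    ‖rotLin e f θ x‖ = ‖x‖ := by
  rw [← sq_eq_sq₀ (norm_nonneg _) (norm_nonneg _), WithLp.prod_norm_sq_eq_of_L2,
    WithLp.prod_norm_sq_eq_of_L2, rotLin_fst_norm_sq he, rotLin_snd_norm_sq hf]
  linear_combination (⟪e, x.fst⟫_ℝ ^ 2 + ⟪f, x.snd⟫_ℝ ^ 2) * Real.sin_sq_add_cos_sq θ

theorem rotLin_rotLin (he : ‖e‖ = 1) (hf : ‖f‖ = 1) (a b : ℝ) (x : WithLp 2 (Y × Z)) :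
    rotLin e f a (rotLin e f b x) = rotLin e f (a + b) x := by
  have he' : ⟪e, e⟫_ℝ = 1 := by rw [real_inner_self_eq_norm_sq, he, one_pow]
  have hf' : ⟪f, f⟫_ℝ = 1 := by rw [real_inner_self_eq_norm_sq, hf, one_pow]
  refine (WithLp.ofLp_injective 2) (Prod.ext ?_ ?_)
  · change (rotLin e f a (rotLin e f b x)).fst = (rotLin e f (a + b) x).fst
    simp only [rotLin_fst, rotLin_snd, inner_add_right, inner_smul_right, he', hf', Real.cos_add,
      Real.sin_add]
    module
  · change (rotLin e f a (rotLin e f b x)).snd = (rotLin e f (a + b) x).snd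
    simp only [rotLin_fst, rotLin_snd, inner_add_right, inner_smul_right, he', hf', Real.cos_add,
      Real.sin_add]
    module

/-- Rotating a cone back by at most its opening angle does not decrease the signed distance. -/
theorem coneFun_le_coneFun_rotLin (he : ‖e‖ = 1) (hf : ‖f‖ = 1) {θ₁ θ₂ : ℝ} (h0 : 0 ≤ θ₂)
    (h12 : θ₂ ≤ θ₁) (h1 : θ₁ ≤ Real.pi / 2) {x : WithLp 2 (Y × Z)} (hx : 0 < coneFun θ₁ x) :
    coneFun θ₁ x ≤ coneFun θ₂ (rotLin e f (θ₂ - θ₁) x) := by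
  obtain ⟨φ, rfl⟩ : ∃ φ, θ₁ = θ₂ + φ := ⟨θ₁ - θ₂, by ring⟩
  have hφ : 0 ≤ φ := by linarith
  rw [show θ₂ - (θ₂ + φ) = -φ by ring]
  have hy := rotLin_fst_norm_sq (f := f) he (-φ) x
  have hz := rotLin_snd_norm_sq (e := e) hf (-φ) x
  rw [Real.cos_neg, Real.sin_neg] at hy hz
  have ha : |⟪e, x.fst⟫_ℝ| ≤ ‖x.fst‖ := by simpa [he] using abs_real_inner_le_norm e x.fst
  have hb : |⟪f, x.snd⟫_ℝ| ≤ ‖x.snd‖ := by simpa [hf] using abs_real_inner_le_norm f x.snd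
  have hA : 0 ≤ ‖x.fst‖ := norm_nonneg _
  have hZ : 0 ≤ ‖x.snd‖ := norm_nonneg _
  have hA₁ : 0 ≤ ‖(rotLin e f (-φ) x).fst‖ := norm_nonneg _
  have hZ₁ : 0 ≤ ‖(rotLin e f (-φ) x).snd‖ := norm_nonneg _
  simp only [coneFun] at hx ⊢
  generalize ‖(rotLin e f (-φ) x).fst‖ = A₁ at *
  generalize ‖(rotLin e f (-φ) x).snd‖ = Z₁ at *
  generalize ‖x.fst‖ = A at *
  generalize ‖x.snd‖ = Z at *
  generalize ⟪e, x.fst⟫_ℝ = a at *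
  generalize ⟪f, x.snd⟫_ℝ = b at *
  have hs : 0 ≤ Real.sin φ := Real.sin_nonneg_of_nonneg_of_le_pi hφ (by linarith [Real.pi_pos])
  have hc : 0 ≤ Real.cos φ := Real.cos_nonneg_of_mem_Icc ⟨by linarith [Real.pi_pos], by linarith⟩
  have hs1 : 0 ≤ Real.sin (θ₂ + φ) :=
    Real.sin_nonneg_of_nonneg_of_le_pi (by linarith) (by linarith [Real.pi_pos])
  have hc1 : 0 ≤ Real.cos (θ₂ + φ) :=
    Real.cos_nonneg_of_mem_Icc ⟨by linarith [Real.pi_pos], by linarith⟩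
  have hs2 : 0 ≤ Real.sin θ₂ := Real.sin_nonneg_of_nonneg_of_le_pi h0 (by linarith [Real.pi_pos])
  have hc2 : 0 ≤ Real.cos θ₂ := Real.cos_nonneg_of_mem_Icc ⟨by linarith [Real.pi_pos], by linarith⟩
  have hsc := Real.sin_sq_add_cos_sq φ
  have hc1' : 0 < Real.cos (θ₂ + φ) := by
    rcases hc1.eq_or_lt with h | h
    · rw [← h] at hx; nlinarith
    · exact h
  -- the rotation angle does not exceed the angle between `x` and `{z = 0}`
  have hkey : Real.sin φ * A ≤ Real.cos φ * Z := by
    have h3 : Real.sin φ * Real.cos (θ₂ + φ) ≤ Real.cos φ * Real.sin (θ₂ + φ) := by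
      have := Real.sin_sub (θ₂ + φ) φ
      rw [add_sub_cancel_right] at this
      linarith
    refine le_of_mul_le_mul_right ?_ hc1'
    nlinarith [mul_le_mul_of_nonneg_right h3 hA, mul_le_mul_of_nonneg_left hx.le hc]
  have hab : a * b ≤ |a| * Z := by
    calc a * b ≤ |a * b| := le_abs_self _
      _ = |a| * |b| := abs_mul a b
      _ ≤ |a| * Z := by gcongr
  have hb2 : b ^ 2 ≤ Z ^ 2 := by rw [← sq_abs]; gcongr
  -- With (A, Z) = |x| (cos ω, sin ω) the right-hand side is |x| cos(ω - φ): the rotation lowers the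
  -- elevation ω by at most φ.
  have hAA : A₁ ≤ Real.cos φ * A + Real.sin φ * Z := by
    refine (abs_le_of_sq_le_sq' ?_ (by positivity)).2
    rw [hy]
    -- Once b is eliminated through |b| ≤ Z, the remaining inequality has the factor A - |a| ≥ 0,
    -- and (A + |a|) sin φ ≤ 2A sin φ ≤ 2Z cos φ by `hkey`.
    have h4 : Real.sin φ * (A + |a|) * (A - |a|) ≤ 2 * (Real.cos φ * Z) * (A - |a|) := by
      refine mul_le_mul_of_nonneg_right ?_ (by linarith)
      nlinarith
    have h5 := mul_le_mul_of_nonneg_left h4 hs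
    have h6 := mul_le_mul_of_nonneg_left hab (mul_nonneg hs hc)
    have h7 := mul_le_mul_of_nonneg_left hb2 (sq_nonneg (Real.sin φ))
    have h8 : |a| ^ 2 = a ^ 2 := sq_abs a
    have h9 : Real.cos φ ^ 2 = 1 - Real.sin φ ^ 2 := by linarith
    have e1 : (Real.cos φ * a - -Real.sin φ * b) ^ 2 = (1 - Real.sin φ ^ 2) * a ^ 2 +
        2 * (Real.sin φ * Real.cos φ * (a * b)) + Real.sin φ ^ 2 * b ^ 2 := by
      rw [← h9]; ring
    have e2 : (Real.cos φ * A + Real.sin φ * Z) ^ 2 = (1 - Real.sin φ ^ 2) * A ^ 2 +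
        2 * (Real.sin φ * Real.cos φ * (A * Z)) + Real.sin φ ^ 2 * Z ^ 2 := by
      rw [← h9]; ring
    rw [e1, e2]
    have e3 : Real.sin φ * (Real.sin φ * (A + |a|) * (A - |a|)) =
        Real.sin φ ^ 2 * A ^ 2 - Real.sin φ ^ 2 * a ^ 2 := by rw [← h8]; ring
    have e4 : Real.sin φ * (2 * (Real.cos φ * Z) * (A - |a|)) =
        2 * (Real.sin φ * Real.cos φ * (A * Z)) - 2 * (Real.sin φ * Real.cos φ * (|a| * Z)) := by
      ring
    rw [e3, e4] at h5
    linarith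
  -- Both rotations, in the plane of e and f and of the pair (A, Z), preserve the sum of squares, so
  -- an upper bound for A₁ is a lower bound for Z₁.
  have hZZ : Real.cos φ * Z - Real.sin φ * A ≤ Z₁ := by
    refine (abs_le_of_sq_le_sq' ?_ hZ₁).2
    have h10 := pow_le_pow_left₀ hA₁ hAA 2
    have h11 : A₁ ^ 2 + Z₁ ^ 2 = A ^ 2 + Z ^ 2 := by
      rw [hy, hz]; linear_combination (a ^ 2 + b ^ 2) * hsc
    have h12 : (Real.cos φ * A + Real.sin φ * Z) ^ 2 + (Real.cos φ * Z - Real.sin φ * A) ^ 2 =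
        A ^ 2 + Z ^ 2 := by linear_combination (A ^ 2 + Z ^ 2) * hsc
    linarith
  rw [Real.cos_add, Real.sin_add]
  have h13 := mul_le_mul_of_nonneg_left hZZ hc2
  have h14 := mul_le_mul_of_nonneg_left hAA hs2
  linarith

/-- The cone `|z| > tan θ |y|`, moved so that the boundary ray through `cos θ e + sin θ f` comes to
lie in the direction of `e` and its point at distance one from the vertex is the origin. -/
def tiltedCone (e : Y) (f : Z) (θ : ℝ) : Set (WithLp 2 (Y × Z)) :=
  {x | 0 < coneFun θ (rotLin e f θ (WithLp.toLp 2 (e, 0) + x))}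

/-- Rotation angles add, so the two motions differ by the rotation by θ₂ - θ₁. -/
theorem tiltedCone_subset (he : ‖e‖ = 1) (hf : ‖f‖ = 1) {θ₁ θ₂ : ℝ} (h0 : 0 ≤ θ₂)
    (h12 : θ₂ ≤ θ₁) (h1 : θ₁ ≤ Real.pi / 2) : tiltedCone e f θ₁ ⊆ tiltedCone e f θ₂ := by
  intro x hx
  have := coneFun_le_coneFun_rotLin he hf h0 h12 h1 hx
  rw [rotLin_rotLin he hf, sub_add_cancel] at this
  exact lt_of_lt_of_le hx this

theorem isOpen_tiltedCone [FiniteDimensional ℝ Y] [FiniteDimensional ℝ Z] (e : Y) (f : Z) (θ : ℝ) :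
    IsOpen (tiltedCone e f θ) := by
  refine isOpen_lt continuous_const ?_
  have h1 := (rotLin e f θ).continuous_of_finiteDimensional
  exact continuous_coneFun.comp (continuous_const.prodMk (h1.comp (by fun_prop)))

theorem coneFun_rotLin_plane (he : ‖e‖ = 1) (hf : ‖f‖ = 1) (θ a b : ℝ) :
    coneFun θ (rotLin e f θ (WithLp.toLp 2 (a • e, b • f))) =
      Real.cos θ * |Real.sin θ * a + Real.cos θ * b| -
        Real.sin θ * |Real.cos θ * a - Real.sin θ * b| := by
  have he' : ⟪e, e⟫_ℝ = 1 := by rw [real_inner_self_eq_norm_sq, he, one_pow]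
  have hf' : ⟪f, f⟫_ℝ = 1 := by rw [real_inner_self_eq_norm_sq, hf, one_pow]
  have h1 : (rotLin e f θ (WithLp.toLp 2 (a • e, b • f))).fst =
      (Real.cos θ * a - Real.sin θ * b) • e := by
    rw [rotLin_fst]
    simp only [WithLp.toLp_fst, WithLp.toLp_snd, inner_smul_right, he', hf']
    module
  have h2 : (rotLin e f θ (WithLp.toLp 2 (a • e, b • f))).snd =
      (Real.sin θ * a + Real.cos θ * b) • f := by
    rw [rotLin_snd]
    simp only [WithLp.toLp_fst, WithLp.toLp_snd, inner_smul_right, he', hf']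
    module
  rw [coneFun, h1, h2, norm_smul, norm_smul, he, hf, mul_one, mul_one, Real.norm_eq_abs,
    Real.norm_eq_abs]

/-- Along the normal segment e + σf the function equals σ exactly, as long as the rotated point
stays in the quadrant spanned by e and f; `h2` and `h3` ensure this for |σ| ≤ ρ. Being 1-Lipschitz,
the function keeps its sign within distance ρ of ±ρf. -/
theorem tangentBalls_tiltedCone (he : ‖e‖ = 1) (hf : ‖f‖ = 1) {θ ρ : ℝ} (hρ : 0 ≤ ρ)
    (h0 : 0 ≤ Real.sin θ) (h1 : 0 ≤ Real.cos θ)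
    (h2 : ρ * Real.sin θ ≤ Real.cos θ) (h3 : ρ * Real.cos θ ≤ Real.sin θ) :
    TangentBalls (WithLp.toLp 2 ((0 : Y), f)) ρ (tiltedCone e f θ) := by
  have key : ∀ σ : ℝ, |σ| ≤ ρ → coneFun θ (rotLin e f θ
      (WithLp.toLp 2 (e, 0) + σ • WithLp.toLp 2 ((0 : Y), f))) = σ := by
    intro σ hσ
    have hσ' := abs_le.1 hσ
    rw [show WithLp.toLp 2 (e, (0 : Z)) + σ • WithLp.toLp 2 ((0 : Y), f) =
      WithLp.toLp 2 ((1 : ℝ) • e, σ • f) by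
        rw [← WithLp.toLp_smul, ← WithLp.toLp_add]; simp, coneFun_rotLin_plane he hf,
      abs_of_nonneg (by nlinarith), abs_of_nonneg (by nlinarith)]
    linear_combination σ * Real.sin_sq_add_cos_sq θ
  have lip : ∀ x c : WithLp 2 (Y × Z),
      |coneFun θ (rotLin e f θ (WithLp.toLp 2 (e, 0) + x)) -
        coneFun θ (rotLin e f θ (WithLp.toLp 2 (e, 0) + c))| ≤ dist x c := by
    intro x c
    refine (abs_coneFun_sub_le _ _ _).trans ?_
    rw [dist_eq_norm, ← map_sub, norm_rotLin he hf, add_sub_add_left_eq_sub, dist_eq_norm]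
  constructor
  · intro x hx
    have := abs_le.1 (lip x (ρ • WithLp.toLp 2 ((0 : Y), f)))
    rw [key ρ (abs_of_nonneg hρ).le] at this
    rw [Metric.mem_ball] at hx
    change 0 < coneFun θ _
    linarith [this.1]
  · intro x hx
    have := abs_le.1 (lip x (-(ρ • WithLp.toLp 2 ((0 : Y), f))))
    rw [← neg_smul, key (-ρ) (by rw [abs_neg, abs_of_nonneg hρ])] at this
    rw [Metric.mem_ball, ← neg_smul] at hx
    change ¬ 0 < coneFun θ _
    linarith [this.2]

theorem exists_tiltedCone_sdiff_mem_nhds [FiniteDimensional ℝ Y] [FiniteDimensional ℝ Z]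
    (he : ‖e‖ = 1) (hf : ‖f‖ = 1) {θ₁ θ₂ : ℝ} (h0 : 0 ≤ θ₂) (h12 : θ₂ < θ₁)
    (h1 : θ₁ ≤ Real.pi / 2) :
    ∃ x, tiltedCone e f θ₂ \ tiltedCone e f θ₁ ∈ 𝓝 x := by
  -- Rotating the direction ψ by θ₂ gives the angle π - θ₁, by θ₁ the angle π - θ₂. Folded into the
  -- first quadrant these are θ₁ > θ₂ and θ₂ < θ₁, so the point is inside the second cone and
  -- outside the first.
  set ψ := Real.pi - θ₁ - θ₂ with hψ
  have hpt : ∀ θ, coneFun θ (rotLin e f θ (WithLp.toLp 2 (e, 0) +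
      (WithLp.toLp 2 (Real.cos ψ • e, Real.sin ψ • f) - WithLp.toLp 2 (e, 0)))) =
      Real.cos θ * |Real.sin (θ + ψ)| - Real.sin θ * |Real.cos (θ + ψ)| := by
    intro θ
    rw [add_sub_cancel, coneFun_rotLin_plane he hf, Real.sin_add, Real.cos_add]
  have hs1 : 0 ≤ Real.sin θ₁ :=
    Real.sin_nonneg_of_nonneg_of_le_pi (by linarith) (by linarith [Real.pi_pos])
  have hc1 : 0 ≤ Real.cos θ₁ :=
    Real.cos_nonneg_of_mem_Icc ⟨by linarith [Real.pi_pos], by linarith⟩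
  have hs2 : 0 ≤ Real.sin θ₂ := Real.sin_nonneg_of_nonneg_of_le_pi h0 (by linarith [Real.pi_pos])
  have hc2 : 0 ≤ Real.cos θ₂ := Real.cos_nonneg_of_mem_Icc ⟨by linarith [Real.pi_pos], by linarith⟩
  have hpos : 0 < Real.sin (θ₁ - θ₂) :=
    Real.sin_pos_of_pos_of_lt_pi (by linarith) (by linarith [Real.pi_pos])
  rw [Real.sin_sub] at hpos
  refine ⟨WithLp.toLp 2 (Real.cos ψ • e, Real.sin ψ • f) - WithLp.toLp 2 (e, 0), ?_⟩
  have hcont : ∀ θ, Continuous fun x => coneFun θ (rotLin e f θ (WithLp.toLp 2 (e, 0) + x)) := by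
    intro θ
    have h1 := (rotLin e f θ).continuous_of_finiteDimensional
    exact continuous_coneFun.comp (continuous_const.prodMk (h1.comp (by fun_prop)))
  have n2 := (isOpen_lt continuous_const (hcont θ₂)).mem_nhds
    (x := WithLp.toLp 2 (Real.cos ψ • e, Real.sin ψ • f) - WithLp.toLp 2 (e, 0)) (by
      change (0 : ℝ) < _
      rw [hpt, show θ₂ + ψ = Real.pi - θ₁ by rw [hψ]; ring, Real.sin_pi_sub, Real.cos_pi_sub,
        abs_neg, abs_of_nonneg hs1, abs_of_nonneg hc1]
      linarith)
  have n1 := (isOpen_lt (hcont θ₁) continuous_const).mem_nhds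
    (x := WithLp.toLp 2 (Real.cos ψ • e, Real.sin ψ • f) - WithLp.toLp 2 (e, 0)) (by
      change _ < (0 : ℝ)
      rw [hpt, show θ₁ + ψ = Real.pi - θ₂ by rw [hψ]; ring, Real.sin_pi_sub, Real.cos_pi_sub,
        abs_neg, abs_of_nonneg hs2, abs_of_nonneg hc2]
      linarith)
  filter_upwards [n1, n2] with x hx1 hx2
  exact ⟨hx2, fun h => lt_asymm (show _ < (0 : ℝ) from hx1) h⟩

theorem zero_notMem_tiltedCone (he : ‖e‖ = 1) (hf : ‖f‖ = 1) {θ : ℝ} (h0 : 0 ≤ Real.sin θ)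
    (h1 : 0 ≤ Real.cos θ) : (0 : WithLp 2 (Y × Z)) ∉ tiltedCone e f θ := by
  have := coneFun_rotLin_plane he hf θ 1 0
  rw [one_smul, zero_smul, mul_one, mul_one, mul_zero, mul_zero, add_zero, sub_zero,
    abs_of_nonneg h0, abs_of_nonneg h1] at this
  intro h
  change 0 < coneFun θ _ at h
  rw [add_zero, this] at h
  linarith

theorem tendsto_evenSgn_tiltedCone {θ₀ : ℝ} {x : WithLp 2 (Y × Z)}
    (h1 : coneFun θ₀ (rotLin e f θ₀ (WithLp.toLp 2 (e, 0) + x)) ≠ 0)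
    (h2 : coneFun θ₀ (rotLin e f θ₀ (WithLp.toLp 2 (e, 0) - x)) ≠ 0) :
    Tendsto (fun θ => evenSgn (tiltedCone e f θ) x) (𝓝 θ₀)
      (𝓝 (evenSgn (tiltedCone e f θ₀) x)) := by
  have hcont : ∀ v : WithLp 2 (Y × Z), Continuous fun θ => coneFun θ (rotLin e f θ v) := fun v =>
    continuous_coneFun.comp (continuous_id.prodMk (continuous_rotLin e f v))
  have key : ∀ v, coneFun θ₀ (rotLin e f θ₀ (WithLp.toLp 2 (e, 0) + v)) ≠ 0 →
      Tendsto (fun θ => sgn (tiltedCone e f θ) v) (𝓝 θ₀) (𝓝 (sgn (tiltedCone e f θ₀) v)) := by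
    intro v hv
    refine tendsto_const_nhds.congr' ?_
    rcases lt_or_gt_of_ne hv with h | h
    · filter_upwards [(hcont _).continuousAt.eventually_lt_const h] with θ hθ
      rw [sgn_of_notMem (A := tiltedCone e f θ) fun h' => lt_asymm hθ h',
        sgn_of_notMem (A := tiltedCone e f θ₀) fun h' => lt_asymm h h']
    · filter_upwards [(hcont _).continuousAt.eventually_const_lt h] with θ hθ
      rw [sgn_of_mem (A := tiltedCone e f θ) hθ, sgn_of_mem (show v ∈ tiltedCone e f θ₀ from h)]
  exact ((key x h1).add (key (-x) (by rwa [← sub_eq_add_neg]))).div_const 2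

/-! ### Null boundaries and almost everywhere limits. -/

section Measure

variable [FiniteDimensional ℝ Y] [MeasurableSpace Y] [BorelSpace Y] [Nontrivial Y]
  [FiniteDimensional ℝ Z] [MeasurableSpace Z] [BorelSpace Z] [Nontrivial Z]

/-- By Fubini: the fibre over y lies in a sphere of Z, or is empty for y ≠ 0 when cos θ = 0, a case
needed at the endpoint π/2. -/
theorem volume_coneFun_eq_zero (θ : ℝ) : volume {x : WithLp 2 (Y × Z) | coneFun θ x = 0} = 0 := by
  have hmeas : MeasurableSet {q : Y × Z | Real.cos θ * ‖q.2‖ - Real.sin θ * ‖q.1‖ = 0} :=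
    (isClosed_eq (by fun_prop) continuous_const).measurableSet
  have h := (WithLp.volume_preserving_ofLp Y Z).measure_preimage hmeas.nullMeasurableSet
  change volume ((WithLp.ofLp : WithLp 2 (Y × Z) → Y × Z) ⁻¹'
    {q : Y × Z | Real.cos θ * ‖q.2‖ - Real.sin θ * ‖q.1‖ = 0}) = 0
  rw [h, Measure.volume_eq_prod, Measure.measure_prod_null hmeas]
  by_cases hc : Real.cos θ = 0
  · have hs : Real.sin θ ≠ 0 := by
      intro hs
      have := Real.sin_sq_add_cos_sq θ
      simp [hs, hc] at this
    have h0 : ∀ᵐ y : Y, y ≠ 0 := by simp [ae_iff]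
    filter_upwards [h0] with y hy
    have : Prod.mk y ⁻¹' {q : Y × Z | Real.cos θ * ‖q.2‖ - Real.sin θ * ‖q.1‖ = 0} = ∅ := by
      ext z; simp [hc, hs, hy]
    rw [this]; simp
  · refine ae_of_all _ fun y => ?_
    refine measure_mono_null ?_
      (Measure.addHaar_sphere volume (0 : Z) (Real.sin θ * ‖y‖ / Real.cos θ))
    intro z hz
    have hz' : Real.cos θ * ‖z‖ - Real.sin θ * ‖y‖ = 0 := hz
    rw [mem_sphere_zero_iff_norm, eq_div_iff hc]
    linarith

theorem ae_coneFun_ne_zero (he : ‖e‖ = 1) (hf : ‖f‖ = 1) (θ : ℝ) :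
    ∀ᵐ x : WithLp 2 (Y × Z), coneFun θ (rotLin e f θ (WithLp.toLp 2 (e, 0) + x)) ≠ 0 := by
  let R : WithLp 2 (Y × Z) →ₗᵢ[ℝ] WithLp 2 (Y × Z) := ⟨rotLin e f θ, norm_rotLin he hf θ⟩
  have hmp : MeasurePreserving (fun x => R.toLinearIsometryEquiv rfl (WithLp.toLp 2 (e, 0) + x)) :=
    (R.toLinearIsometryEquiv rfl).measurePreserving.comp (measurePreserving_add_left volume _)
  have := hmp.quasiMeasurePreserving.preimage_null (volume_coneFun_eq_zero (Y := Y) (Z := Z) θ)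
  rw [ae_iff]
  convert this using 2
  ext x
  simp [R]

theorem ae_tendsto_evenSgn_tiltedCone (he : ‖e‖ = 1) (hf : ‖f‖ = 1) (θ₀ : ℝ) :
    ∀ᵐ x : WithLp 2 (Y × Z), Tendsto (fun θ => evenSgn (tiltedCone e f θ) x) (𝓝 θ₀)
      (𝓝 (evenSgn (tiltedCone e f θ₀) x)) := by
  have h := ae_coneFun_ne_zero he hf θ₀ (Y := Y) (Z := Z)
  have h' := (Measure.measurePreserving_neg (volume : Measure (WithLp 2 (Y × Z)))).quasiMeasurePreserving.ae h
  filter_upwards [h, h'] with x h1 h2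
  exact tendsto_evenSgn_tiltedCone h1 (by rwa [sub_eq_add_neg])

/-- At angle 0 the cone is {z ≠ 0}, which has full measure. -/
theorem ae_evenSgn_tiltedCone_zero (he : ‖e‖ = 1) (hf : ‖f‖ = 1) :
    ∀ᵐ x : WithLp 2 (Y × Z), evenSgn (tiltedCone e f 0) x = 1 := by
  have h := ae_coneFun_ne_zero he hf 0 (Y := Y) (Z := Z)
  have h' := (Measure.measurePreserving_neg (volume : Measure (WithLp 2 (Y × Z)))).quasiMeasurePreserving.ae h
  have key : ∀ x, coneFun 0 (rotLin e f 0 (WithLp.toLp 2 (e, 0) + x)) ≠ 0 →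
      x ∈ tiltedCone e f 0 := fun x hx => by
    refine lt_of_le_of_ne ?_ hx.symm
    rw [coneFun_zero]; exact norm_nonneg _
  filter_upwards [h, h'] with x h1 h2
  rw [evenSgn, sgn_of_mem (key x h1), sgn_of_mem (key _ h2)]
  norm_num

end Measure

theorem evenSgn_tiltedCone_pi_div_two (x : WithLp 2 (Y × Z)) :
    evenSgn (tiltedCone e f (Real.pi / 2)) x = -1 := by
  have key : ∀ x, x ∉ tiltedCone e f (Real.pi / 2) := fun x hx => by
    have : 0 < coneFun (Real.pi / 2) _ := hx
    rw [coneFun_pi_div_two] at this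
    linarith [norm_nonneg (rotLin e f (Real.pi / 2) (WithLp.toLp 2 (e, 0) + x)).fst]
  rw [evenSgn, sgn_of_notMem (key x), sgn_of_notMem (key _)]
  norm_num

end Cone

/-! ### Behaviour under isometries and dilations. -/

section Transport

variable {V : Type*} [NormedAddCommGroup V] [InnerProductSpace ℝ V] [FiniteDimensional ℝ V]
  [MeasurableSpace V] [BorelSpace V]

theorem hasNonlocalMeanCurvature_preimage_iff (s : ℝ) (L : V ≃ₗᵢ[ℝ] V) (q : V) (E : Set V) (h : ℝ) :
    HasNonlocalMeanCurvature s ((fun x => L (q + x)) ⁻¹' E) 0 h ↔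
      HasNonlocalMeanCurvature s E (L q) h := by
  have hmp : MeasurePreserving (fun x => L (q + x)) :=
    L.measurePreserving.comp (measurePreserving_add_left volume q)
  have hemb : MeasurableEmbedding (fun x => L (q + x)) :=
    L.toMeasurableEquiv.measurableEmbedding.comp (measurableEmbedding_addLeft q)
  have hball : ∀ δ : ℝ, (Metric.ball (0 : V) δ)ᶜ =
      (fun x => L (q + x)) ⁻¹' (Metric.ball (L q) δ)ᶜ := by
    intro δ
    ext x
    simp [dist_eq_norm]
  have hpoint : ∀ x, curvatureIntegrand s ((fun x => L (q + x)) ⁻¹' E) 0 x =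
      curvatureIntegrand s E (L q) (L (q + x)) := by
    intro x
    rw [curvatureIntegrand_eq, curvatureIntegrand_eq, sgn_preimage, kernel, kernel, ← map_sub,
      L.norm_map, sub_zero, add_sub_cancel_left]
  have hcomp : curvatureIntegrand s ((fun x => L (q + x)) ⁻¹' E) 0 =
      curvatureIntegrand s E (L q) ∘ fun x => L (q + x) := funext hpoint
  unfold HasNonlocalMeanCurvature
  refine and_congr (forall₂_congr fun δ _ => ?_) ?_
  · rw [hball, hcomp, hmp.integrableOn_comp_preimage hemb]
  · have : ∀ δ : ℝ, ∫ x in (Metric.ball (0 : V) δ)ᶜ,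
        curvatureIntegrand s ((fun x => L (q + x)) ⁻¹' E) 0 x =
        ∫ x in (Metric.ball (L q) δ)ᶜ, curvatureIntegrand s E (L q) x := by
      intro δ
      rw [hball, hcomp]
      exact hmp.setIntegral_preimage_emb hemb _ _
    simp only [this]

theorem hasNonlocalMeanCurvature_map_iff (s : ℝ) (L : V ≃ₗᵢ[ℝ] V) (q : V) {E : Set V}
    (hE : L ⁻¹' E = E) (h : ℝ) :
    HasNonlocalMeanCurvature s E (L q) h ↔ HasNonlocalMeanCurvature s E q h := by
  rw [← hasNonlocalMeanCurvature_preimage_iff]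
  refine Iff.trans ?_ (hasNonlocalMeanCurvature_preimage_iff s (LinearIsometryEquiv.refl ℝ V) q E h)
  have : (fun x => L (q + x)) ⁻¹' E = (fun x => LinearIsometryEquiv.refl ℝ V (q + x)) ⁻¹' E := by
    conv_rhs => rw [← hE]
    rfl
  rw [this]

/-- The kernel contributes t^(N+s) and the Jacobian t^(-N). -/
theorem curv_preimage_smul (s : ℝ) {t : ℝ} (ht : 0 < t) (A : Set V) :
    curv s ((fun x => t • x) ⁻¹' A) = t ^ s * curv s A := by
  have h : ∀ x : V, evenSgn ((fun x => t • x) ⁻¹' A) x * kernel s x =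
      t ^ ((Module.finrank ℝ V : ℝ) + s) * (evenSgn A (t • x) * kernel s (t • x)) := by
    intro x
    have hk : kernel s x = t ^ ((Module.finrank ℝ V : ℝ) + s) * kernel s (t • x) := by
      rw [kernel, kernel, norm_smul, Real.norm_of_nonneg ht.le,
        Real.mul_rpow ht.le (norm_nonneg _), mul_inv, mul_inv_cancel_left₀ (by positivity)]
    rw [evenSgn, evenSgn, sgn_preimage, sgn_preimage, hk, smul_neg]
    ring
  rw [curv, curv]
  simp only [h]
  rw [integral_const_mul, Measure.integral_comp_smul volume
    (fun x => evenSgn A x * kernel s x) t, smul_eq_mul, abs_of_pos (by positivity), ← mul_assoc,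
    Real.rpow_add ht, Real.rpow_natCast, mul_right_comm _ _ (_⁻¹), mul_inv_cancel₀ (by positivity),
    one_mul]

end Transport

theorem TangentBalls.preimage_smul {V : Type*} [NormedAddCommGroup V] [InnerProductSpace ℝ V]
    {ν : V} {ρ : ℝ} {A : Set V} (h : TangentBalls ν ρ A) {t : ℝ} (ht : 0 < t) :
    TangentBalls ν (ρ / t) ((fun x => t • x) ⁻¹' A) := by
  have key : ∀ c x : V, dist x (t⁻¹ • c) < ρ / t → dist (t • x) c < ρ := by
    intro c x hx
    have := dist_smul₀ t x (t⁻¹ • c)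
    rw [smul_inv_smul₀ ht.ne', Real.norm_of_nonneg ht.le] at this
    rw [this, mul_comm]
    exact (lt_div_iff₀ ht).1 hx
  have e : (ρ / t) • ν = t⁻¹ • (ρ • ν) := by rw [smul_smul, div_eq_inv_mul]
  refine ⟨fun x hx => h.1 (key _ _ ?_), fun x hx => h.2 (key _ _ ?_)⟩
  · rwa [← e]
  · rwa [smul_neg, ← e]

theorem sin_cos_pos {θ : ℝ} (hθ : θ ∈ Ioo 0 (Real.pi / 2)) : 0 < Real.sin θ ∧ 0 < Real.cos θ :=
  ⟨Real.sin_pos_of_pos_of_lt_pi hθ.1 (by linarith [hθ.2, Real.pi_pos]),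
    Real.cos_pos_of_mem_Ioo ⟨by linarith [hθ.1, Real.pi_pos], hθ.2⟩⟩

/-- These are the conditions of `tangentBalls_tiltedCone` for ρ = sin θ cos θ, with gaps cos³ θ and
sin³ θ. Strictness lets the same radius serve nearby angles. -/
theorem sin_mul_cos_bounds {θ : ℝ} (hθ : θ ∈ Ioo 0 (Real.pi / 2)) :
    0 < Real.sin θ * Real.cos θ ∧ Real.sin θ * Real.cos θ * Real.sin θ < Real.cos θ ∧
      Real.sin θ * Real.cos θ * Real.cos θ < Real.sin θ := by
  obtain ⟨h0, h1⟩ := sin_cos_pos hθ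
  have h := Real.sin_sq_add_cos_sq θ
  refine ⟨mul_pos h0 h1, ?_, ?_⟩
  · have : Real.cos θ - Real.sin θ * Real.cos θ * Real.sin θ = Real.cos θ ^ 3 := by
      linear_combination -Real.cos θ * h
    linarith [pow_pos h1 3]
  · have : Real.sin θ - Real.sin θ * Real.cos θ * Real.cos θ = Real.sin θ ^ 3 := by
      linear_combination -Real.sin θ * h
    linarith [pow_pos h0 3]

theorem norm_toLp_zero_left {Y Z : Type*} [NormedAddCommGroup Y] [NormedAddCommGroup Z]
    {f : Z} (hf : ‖f‖ = 1) : ‖WithLp.toLp 2 ((0 : Y), f)‖ = 1 := by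
  rw [WithLp.norm_toLp_snd, hf]

/-! ### The curvature as a function of the angle, and its unique zero. -/

section Cone

variable {Y Z : Type*} [NormedAddCommGroup Y] [InnerProductSpace ℝ Y]
  [NormedAddCommGroup Z] [InnerProductSpace ℝ Z] {e : Y} {f : Z}

theorem tangentBalls_tiltedCone_of_mem (he : ‖e‖ = 1) (hf : ‖f‖ = 1) {θ : ℝ}
    (hθ : θ ∈ Ioo 0 (Real.pi / 2)) :
    TangentBalls (WithLp.toLp 2 ((0 : Y), f)) (Real.sin θ * Real.cos θ) (tiltedCone e f θ) := by
  obtain ⟨h0, h1⟩ := sin_cos_pos hθ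
  obtain ⟨h2, h3, h4⟩ := sin_mul_cos_bounds hθ
  exact tangentBalls_tiltedCone he hf h2.le h0.le h1.le h3.le h4.le

theorem coneFun_smul (θ : ℝ) {t : ℝ} (ht : 0 ≤ t) (x : WithLp 2 (Y × Z)) :
    coneFun θ (t • x) = t * coneFun θ x := by
  simp only [coneFun, WithLp.smul_fst, WithLp.smul_snd, norm_smul, Real.norm_of_nonneg ht]
  ring

variable [FiniteDimensional ℝ Y] [MeasurableSpace Y] [BorelSpace Y]
  [FiniteDimensional ℝ Z] [MeasurableSpace Z] [BorelSpace Z]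

theorem integrable_tiltedCone {s : ℝ} (hs0 : 0 < s) (hs1 : s < 1) (he : ‖e‖ = 1) (hf : ‖f‖ = 1)
    {θ : ℝ} (hθ : θ ∈ Ioo 0 (Real.pi / 2)) :
    Integrable fun x => evenSgn (tiltedCone e f θ) x * kernel s x :=
  (tangentBalls_tiltedCone_of_mem he hf hθ).integrable hs0 hs1 (norm_toLp_zero_left hf)
    (sin_mul_cos_bounds hθ).1 (isOpen_tiltedCone e f θ).measurableSet

theorem strictAntiOn_curv_tiltedCone {s : ℝ} (hs0 : 0 < s) (hs1 : s < 1) (he : ‖e‖ = 1)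
    (hf : ‖f‖ = 1) :
    StrictAntiOn (fun θ => curv s (tiltedCone e f θ)) (Ioo 0 (Real.pi / 2)) := by
  intro θ₂ h2 θ₁ h1 h21
  obtain ⟨x, hx⟩ := exists_tiltedCone_sdiff_mem_nhds he hf h2.1.le h21 h1.2.le
  exact curv_lt_curv (integrable_tiltedCone hs0 hs1 he hf h1)
    (integrable_tiltedCone hs0 hs1 he hf h2) (tiltedCone_subset he hf h2.1.le h21.le h1.2.le) hx
    fun h => zero_notMem_tiltedCone he hf (sin_cos_pos h2).1.le (sin_cos_pos h2).2.le h.1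

theorem continuousOn_curv_tiltedCone [Nontrivial Y] [Nontrivial Z] {s : ℝ} (hs0 : 0 < s)
    (hs1 : s < 1) (he : ‖e‖ = 1) (hf : ‖f‖ = 1) :
    ContinuousOn (fun θ => curv s (tiltedCone e f θ)) (Ioo 0 (Real.pi / 2)) := by
  intro θ₀ hθ₀
  refine ContinuousAt.continuousWithinAt ?_
  obtain ⟨h2, h3, h4⟩ := sin_mul_cos_bounds hθ₀
  refine tendsto_curv hs0 hs1 (norm_toLp_zero_left hf) h2
    (fun θ => (isOpen_tiltedCone e f θ).measurableSet) ?_ (ae_tendsto_evenSgn_tiltedCone he hf θ₀)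
  -- The radius stays frozen at sin θ₀ cos θ₀ while θ varies, so that one pair of balls works near
  -- θ₀.
  have c3 := (Continuous.continuousAt (x := θ₀) (by fun_prop :
    Continuous fun θ => Real.sin θ₀ * Real.cos θ₀ * Real.sin θ)).eventually_lt
      Real.continuous_cos.continuousAt h3
  have c4 := (Continuous.continuousAt (x := θ₀) (by fun_prop :
    Continuous fun θ => Real.sin θ₀ * Real.cos θ₀ * Real.cos θ)).eventually_lt
      Real.continuous_sin.continuousAt h4
  filter_upwards [c3, c4, isOpen_Ioo.mem_nhds hθ₀] with θ h5 h6 h7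
  exact tangentBalls_tiltedCone he hf h2.le (sin_cos_pos h7).1.le (sin_cos_pos h7).2.le h5.le h6.le

theorem exists_curv_tiltedCone_pos [Nontrivial Y] [Nontrivial Z] {s : ℝ} (hs0 : 0 < s)
    (hs1 : s < 1) (he : ‖e‖ = 1) (hf : ‖f‖ = 1) :
    ∃ θ ∈ Ioo 0 (Real.pi / 2), 0 < curv s (tiltedCone e f θ) := by
  have hπ := Real.pi_pos
  have hmem : Ioo 0 (Real.pi / 4) ∈ 𝓝[>] (0 : ℝ) := Ioo_mem_nhdsGT (by linarith)
  have hsub : ∀ θ ∈ Ioo 0 (Real.pi / 4), θ ∈ Ioo 0 (Real.pi / 2) := fun θ h =>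
    ⟨h.1, by linarith [h.2]⟩
  have hQ : Real.pi / 4 ∈ Ioo 0 (Real.pi / 2) := ⟨by linarith, by linarith⟩
  have : Nontrivial (WithLp 2 (Y × Z)) := ⟨WithLp.toLp 2 (0, f), 0,
    ne_zero_of_norm_ne_zero ((norm_toLp_zero_left hf).trans_ne one_ne_zero)⟩
  have h := eventually_curv_pos (l := 𝓝[>] (0 : ℝ)) (A := tiltedCone e f)
    (B := tiltedCone e f (Real.pi / 4)) hs0 (fun θ => (isOpen_tiltedCone e f θ).measurableSet)
    (by filter_upwards [hmem] with θ hθ using integrable_tiltedCone hs0 hs1 he hf (hsub θ hθ))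
    (integrable_tiltedCone hs0 hs1 he hf hQ)
    (by filter_upwards [hmem] with θ hθ using tiltedCone_subset he hf hθ.1.le hθ.2.le hQ.2.le)
    (by
      filter_upwards [ae_tendsto_evenSgn_tiltedCone he hf 0, ae_evenSgn_tiltedCone_zero he hf]
        with x hx hx1
      rw [hx1] at hx
      exact hx.mono_left nhdsWithin_le_nhds)
  obtain ⟨θ, h1, h2⟩ := (h.and hmem).exists
  exact ⟨θ, hsub θ h2, h1⟩

/-- Complements reverse both the inclusions and the sign of `curv`, so the positivity criterion
applies to them at π/2. -/
theorem exists_curv_tiltedCone_neg [Nontrivial Y] [Nontrivial Z] {s : ℝ} (hs0 : 0 < s)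
    (hs1 : s < 1) (he : ‖e‖ = 1) (hf : ‖f‖ = 1) :
    ∃ θ ∈ Ioo 0 (Real.pi / 2), curv s (tiltedCone e f θ) < 0 := by
  have hπ := Real.pi_pos
  have hmem : Ioo (Real.pi / 4) (Real.pi / 2) ∈ 𝓝[<] (Real.pi / 2) := Ioo_mem_nhdsLT (by linarith)
  have hsub : ∀ θ ∈ Ioo (Real.pi / 4) (Real.pi / 2), θ ∈ Ioo 0 (Real.pi / 2) := fun θ h =>
    ⟨by linarith [h.1], h.2⟩
  have hQ : Real.pi / 4 ∈ Ioo 0 (Real.pi / 2) := ⟨by linarith, by linarith⟩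
  have hcompl : ∀ θ ∈ Ioo 0 (Real.pi / 2),
      Integrable fun x => evenSgn (tiltedCone e f θ)ᶜ x * kernel s x := fun θ hθ => by
    refine (integrable_tiltedCone hs0 hs1 he hf hθ).neg.congr (ae_of_all _ fun x => ?_)
    simp only [evenSgn_compl, neg_mul, Pi.neg_apply]
  have : Nontrivial (WithLp 2 (Y × Z)) := ⟨WithLp.toLp 2 (0, f), 0,
    ne_zero_of_norm_ne_zero ((norm_toLp_zero_left hf).trans_ne one_ne_zero)⟩
  have h := eventually_curv_pos (l := 𝓝[<] (Real.pi / 2)) (A := fun θ => (tiltedCone e f θ)ᶜ)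
    (B := (tiltedCone e f (Real.pi / 4))ᶜ) hs0
    (fun θ => (isOpen_tiltedCone e f θ).measurableSet.compl)
    (by filter_upwards [hmem] with θ hθ using hcompl θ (hsub θ hθ))
    (hcompl _ hQ)
    (by
      filter_upwards [hmem] with θ hθ using
        compl_subset_compl.2 (tiltedCone_subset he hf hQ.1.le hθ.1.le hθ.2.le))
    (by
      filter_upwards [ae_tendsto_evenSgn_tiltedCone he hf (Real.pi / 2)] with x hx
      rw [evenSgn_tiltedCone_pi_div_two] at hx
      simpa only [evenSgn_compl, neg_neg] using (hx.mono_left nhdsWithin_le_nhds).neg)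
  obtain ⟨θ, h1, h2⟩ := (h.and hmem).exists
  rw [curv_compl] at h1
  exact ⟨θ, hsub θ h2, by linarith⟩

theorem existsUnique_curv_tiltedCone_eq_zero [Nontrivial Y] [Nontrivial Z] {s : ℝ} (hs0 : 0 < s)
    (hs1 : s < 1) (he : ‖e‖ = 1) (hf : ‖f‖ = 1) :
    ∃! θ, θ ∈ Ioo 0 (Real.pi / 2) ∧ curv s (tiltedCone e f θ) = 0 := by
  obtain ⟨a, ha, ha'⟩ := exists_curv_tiltedCone_pos hs0 hs1 he hf
  obtain ⟨b, hb, hb'⟩ := exists_curv_tiltedCone_neg hs0 hs1 he hf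
  obtain ⟨θ, hθ, h⟩ := isPreconnected_Ioo.intermediate_value hb ha
    (continuousOn_curv_tiltedCone hs0 hs1 he hf) ⟨hb'.le, ha'.le⟩
  refine ⟨θ, ⟨hθ, h⟩, fun θ' hθ' => ?_⟩
  exact (strictAntiOn_curv_tiltedCone hs0 hs1 he hf).injOn hθ'.1 hθ (hθ'.2.trans h.symm)

/-- The motion x ↦ R(re + x) sends the origin to the boundary point and pulls the cone back to the
dilate of `tiltedCone` by r, whose curvature carries the nonzero factor r^(-s). -/
theorem hasNonlocalMeanCurvature_cone_iff {s : ℝ} (hs0 : 0 < s) (hs1 : s < 1) (he : ‖e‖ = 1)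
    (hf : ‖f‖ = 1) {θ : ℝ} (hθ : θ ∈ Ioo 0 (Real.pi / 2)) {r : ℝ} (hr : 0 < r) :
    HasNonlocalMeanCurvature s {x : WithLp 2 (Y × Z) | 0 < coneFun θ x}
      (r • WithLp.toLp 2 (Real.cos θ • e, Real.sin θ • f)) 0 ↔
      curv s (tiltedCone e f θ) = 0 := by
  let R₀ : WithLp 2 (Y × Z) →ₗᵢ[ℝ] WithLp 2 (Y × Z) := ⟨rotLin e f θ, norm_rotLin he hf θ⟩
  let R := R₀.toLinearIsometryEquiv rfl
  have hR : ∀ x, R x = rotLin e f θ x := fun x => by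
    change (R₀.toLinearIsometryEquiv rfl) x = _
    rw [LinearIsometry.toLinearIsometryEquiv_apply]; rfl
  have hRe : R (WithLp.toLp 2 (e, 0)) = WithLp.toLp 2 (Real.cos θ • e, Real.sin θ • f) := by
    have he' : inner ℝ e e = 1 := by rw [real_inner_self_eq_norm_sq, he, one_pow]
    rw [hR]
    refine (WithLp.ofLp_injective 2) (Prod.ext ?_ ?_)
    · change (rotLin e f θ _).fst = Real.cos θ • e
      rw [rotLin_fst]
      simp only [WithLp.toLp_fst, WithLp.toLp_snd, he', inner_zero_right]
      module
    · change (rotLin e f θ _).snd = Real.sin θ • f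
      rw [rotLin_snd]
      simp only [WithLp.toLp_fst, WithLp.toLp_snd, he', inner_zero_right]
      module
  have hset : (fun x => R (r • WithLp.toLp 2 (e, 0) + x)) ⁻¹'
      {x : WithLp 2 (Y × Z) | 0 < coneFun θ x} = (fun x => r⁻¹ • x) ⁻¹' tiltedCone e f θ := by
    ext x
    change 0 < coneFun θ (R _) ↔ 0 < coneFun θ (rotLin e f θ _)
    rw [show r • WithLp.toLp 2 (e, 0) + x = r • (WithLp.toLp 2 (e, 0) + r⁻¹ • x) by
      rw [smul_add, smul_inv_smul₀ hr.ne'], map_smul, coneFun_smul θ hr.le, hR]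
    exact mul_pos_iff_of_pos_left hr
  rw [← hRe, ← map_smul, ← hasNonlocalMeanCurvature_preimage_iff, hset]
  have hT := (tangentBalls_tiltedCone_of_mem he hf hθ).preimage_smul (inv_pos.2 hr)
  rw [hT.hasNonlocalMeanCurvature_iff hs0 hs1 (norm_toLp_zero_left hf)
    (div_pos (sin_mul_cos_bounds hθ).1 (inv_pos.2 hr))
    ((isOpen_tiltedCone e f θ).preimage (continuous_const_smul _)).measurableSet,
    curv_preimage_smul s (inv_pos.2 hr)]
  have : (r⁻¹ : ℝ) ^ s ≠ 0 := (Real.rpow_pos_of_pos (inv_pos.2 hr) s).ne'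
  simp [this]

/-- Reflections of the two factors carry e to e' and f to f' and preserve the cone. -/
theorem curv_tiltedCone_eq_zero_iff {s : ℝ} (hs0 : 0 < s) (hs1 : s < 1) {e' : Y} {f' : Z}
    (he : ‖e‖ = 1) (hf : ‖f‖ = 1) (he' : ‖e'‖ = 1) (hf' : ‖f'‖ = 1) {θ : ℝ}
    (hθ : θ ∈ Ioo 0 (Real.pi / 2)) :
    curv s (tiltedCone e f θ) = 0 ↔ curv s (tiltedCone e' f' θ) = 0 := by
  rw [← hasNonlocalMeanCurvature_cone_iff hs0 hs1 he hf hθ one_pos,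
    ← hasNonlocalMeanCurvature_cone_iff hs0 hs1 he' hf' hθ one_pos]
  let P := (ℝ ∙ (e - e'))ᗮ.reflection
  let Q := (ℝ ∙ (f - f'))ᗮ.reflection
  have hP : P e = e' := Submodule.reflection_sub (he.trans he'.symm)
  have hQ : Q f = f' := Submodule.reflection_sub (hf.trans hf'.symm)
  let L₀ : WithLp 2 (Y × Z) →ₗᵢ[ℝ] WithLp 2 (Y × Z) :=
    { toFun := fun x => WithLp.toLp 2 (P x.fst, Q x.snd)
      map_add' := fun x x' => by simp [← WithLp.toLp_add]
      map_smul' := fun c x => by simp [← WithLp.toLp_smul]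
      norm_map' := fun x => by
        change ‖WithLp.toLp 2 (P x.fst, Q x.snd)‖ = ‖x‖
        rw [← sq_eq_sq₀ (norm_nonneg _) (norm_nonneg _), WithLp.prod_norm_sq_eq_of_L2,
          WithLp.prod_norm_sq_eq_of_L2]
        simp }
  let L := L₀.toLinearIsometryEquiv rfl
  have hL : ∀ x, L x = WithLp.toLp 2 (P x.fst, Q x.snd) := fun x => by
    change (L₀.toLinearIsometryEquiv rfl) x = _
    rw [LinearIsometry.toLinearIsometryEquiv_apply]; rfl
  have hLp : L ((1 : ℝ) • WithLp.toLp 2 (Real.cos θ • e, Real.sin θ • f)) =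
      (1 : ℝ) • WithLp.toLp 2 (Real.cos θ • e', Real.sin θ • f') := by
    rw [one_smul, one_smul, hL, WithLp.toLp_fst, WithLp.toLp_snd, map_smul, map_smul, hP, hQ]
  rw [← hLp]
  refine (hasNonlocalMeanCurvature_map_iff s L _ ?_ 0).symm
  ext x
  simp [coneFun, hL]

end Cone

/-! ### A smooth defining function. -/

section Quadratic

variable {Y Z : Type*} [NormedAddCommGroup Y] [InnerProductSpace ℝ Y]
  [NormedAddCommGroup Z] [InnerProductSpace ℝ Z]

theorem contDiff_quadratic (α : ℝ) :
    ContDiff ℝ ∞ fun x : WithLp 2 (Y × Z) => ‖x.snd‖ ^ 2 - α ^ 2 * ‖x.fst‖ ^ 2 :=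
  ((WithLp.sndL 2 ℝ Y Z).contDiff.norm_sq ℝ).sub
    (contDiff_const.mul ((WithLp.fstL 2 ℝ Y Z).contDiff.norm_sq ℝ))

theorem fderiv_quadratic_ne_zero {α : ℝ} (hα : 0 < α) {x : WithLp 2 (Y × Z)} (hx : x ≠ 0) :
    fderiv ℝ (fun x : WithLp 2 (Y × Z) => ‖x.snd‖ ^ 2 - α ^ 2 * ‖x.fst‖ ^ 2) x ≠ 0 := by
  intro h0
  -- In the direction (-y, z) both terms increase: the derivative is 2|z|² + 2α²|y|², positive off
  -- the origin.
  have hline : HasDerivAt (fun t : ℝ => x + t • WithLp.toLp 2 (-x.fst, x.snd))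
      (WithLp.toLp 2 (-x.fst, x.snd)) 0 := by
    simpa using ((hasDerivAt_id (0 : ℝ)).smul_const (WithLp.toLp 2 (-x.fst, x.snd))).const_add x
  have hd := (contDiff_quadratic (Y := Y) (Z := Z) α).differentiable (by simp)
  have h1 := (hd (x + (0 : ℝ) • WithLp.toLp 2 (-x.fst, x.snd))).hasFDerivAt.comp_hasDerivAt
    (0 : ℝ) hline
  rw [zero_smul, add_zero, h0] at h1
  have h2 : ((fun x : WithLp 2 (Y × Z) => ‖x.snd‖ ^ 2 - α ^ 2 * ‖x.fst‖ ^ 2) ∘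
      fun t : ℝ => x + t • WithLp.toLp 2 (-x.fst, x.snd)) =
      fun t : ℝ => (1 + t) ^ 2 * ‖x.snd‖ ^ 2 - α ^ 2 * ((1 - t) ^ 2 * ‖x.fst‖ ^ 2) := by
    funext t
    have e1 : (x + t • WithLp.toLp 2 (-x.fst, x.snd)).fst = (1 - t) • x.fst := by
      change x.fst + t • -x.fst = _; module
    have e2 : (x + t • WithLp.toLp 2 (-x.fst, x.snd)).snd = (1 + t) • x.snd := by
      change x.snd + t • x.snd = _; module
    simp only [Function.comp_apply, e1, e2, norm_smul, mul_pow, Real.norm_eq_abs, sq_abs]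
  rw [h2] at h1
  have h3 : HasDerivAt
      (fun t : ℝ => (1 + t) ^ 2 * ‖x.snd‖ ^ 2 - α ^ 2 * ((1 - t) ^ 2 * ‖x.fst‖ ^ 2))
      (2 * ‖x.snd‖ ^ 2 + 2 * (α ^ 2 * ‖x.fst‖ ^ 2)) 0 := by
    have p1 := ((((hasDerivAt_id (0 : ℝ)).const_add 1).pow 2).mul_const (‖x.snd‖ ^ 2)).sub
      (((((hasDerivAt_id (0 : ℝ)).const_sub 1).pow 2).mul_const (‖x.fst‖ ^ 2)).const_mul (α ^ 2))
    refine p1.congr_deriv ?_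
    simp only [id_eq]
    norm_num
    ring
  have h4 := h1.unique h3
  rw [zero_apply] at h4
  have hy : ‖x.fst‖ ^ 2 = 0 := by
    by_contra h
    have := lt_of_le_of_ne (sq_nonneg ‖x.fst‖) (Ne.symm h)
    nlinarith [sq_nonneg ‖x.snd‖, mul_pos (pow_pos hα 2) this]
  have hz : ‖x.snd‖ ^ 2 = 0 := by
    rw [hy] at h4
    linarith
  apply hx
  have := WithLp.prod_norm_sq_eq_of_L2 x
  rw [hy, hz] at this
  simpa using this

end Quadratic

/-! ### Lawson cones and reduction to one boundary point. -/

section Lawson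

variable {m n : ℕ}

theorem isOpen_solidLawsonCone (m n : ℕ) (α : ℝ) : IsOpen (solidLawsonCone m n α) :=
  isOpen_lt (by fun_prop) (by fun_prop)

theorem frontier_solidLawsonCone (hn : 1 ≤ n) (α : ℝ) :
    frontier (solidLawsonCone m n α) = lawsonCone m n α := by
  rw [(isOpen_solidLawsonCone m n α).frontier_eq]
  apply Subset.antisymm
  · rintro x ⟨hx, hx'⟩
    have hcl : IsClosed {x : Space m n | α * ‖x.fst‖ ≤ ‖x.snd‖} :=
      isClosed_le (by fun_prop) (by fun_prop)
    have h1 : α * ‖x.fst‖ ≤ ‖x.snd‖ :=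
      closure_minimal (fun y (hy : α * ‖y.fst‖ < ‖y.snd‖) => hy.le :
        solidLawsonCone m n α ⊆ {x : Space m n | α * ‖x.fst‖ ≤ ‖x.snd‖}) hcl hx
    exact le_antisymm (not_lt.1 hx') h1
  · intro x hx
    have hx1 : ‖x.snd‖ = α * ‖x.fst‖ := hx
    refine ⟨?_, fun h => (show α * ‖x.fst‖ < ‖x.snd‖ from h).ne' hx1⟩
    -- Lengthening z enters the open cone. Where z = 0 any nonzero direction does, and n ≥ 1
    -- provides one.
    obtain ⟨w, hw⟩ : ∃ w : EuclideanSpace ℝ (Fin n),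
        ∀ t : ℝ, 0 < t → ‖x.snd‖ < ‖x.snd + t • w‖ := by
      by_cases h0 : x.snd = 0
      · refine ⟨EuclideanSpace.single ⟨0, hn⟩ 1, fun t ht => ?_⟩
        rw [h0, zero_add, norm_zero, norm_smul]
        simp [ht.ne']
      · refine ⟨x.snd, fun t ht => ?_⟩
        have : x.snd + t • x.snd = (1 + t) • x.snd := by module
        rw [this, norm_smul, Real.norm_of_nonneg (by linarith)]
        nlinarith [norm_pos_iff.2 h0]
    have hlim : Tendsto (fun t : ℝ => x + t • WithLp.toLp 2 ((0 : EuclideanSpace ℝ (Fin m)), w))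
        (𝓝[>] 0) (𝓝 x) := by
      have : Continuous fun t : ℝ =>
          x + t • WithLp.toLp 2 ((0 : EuclideanSpace ℝ (Fin m)), w) := by fun_prop
      have h := this.tendsto 0
      rw [zero_smul, add_zero] at h
      exact h.mono_left nhdsWithin_le_nhds
    refine mem_closure_of_tendsto hlim ?_
    filter_upwards [self_mem_nhdsWithin] with t ht
    change α * ‖x.fst + t • (0 : EuclideanSpace ℝ (Fin m))‖ < ‖x.snd + t • w‖
    rw [smul_zero, add_zero, ← hx1]
    exact hw t ht

theorem isSolidCone_solidLawsonCone (m n : ℕ) (α : ℝ) : IsSolidCone (solidLawsonCone m n α) := by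
  have hsmul : ∀ (t : ℝ) (x : Space m n), 0 < t →
      (t • x ∈ solidLawsonCone m n α ↔ x ∈ solidLawsonCone m n α) := by
    intro t x ht
    change α * ‖(t • x).fst‖ < ‖(t • x).snd‖ ↔ α * ‖x.fst‖ < ‖x.snd‖
    rw [WithLp.smul_fst, WithLp.smul_snd, norm_smul, norm_smul, Real.norm_of_nonneg ht.le,
      mul_left_comm]
    exact mul_lt_mul_iff_right₀ ht
  refine ⟨Subtype.val ⁻¹' solidLawsonCone m n α,
    (isOpen_solidLawsonCone m n α).preimage continuous_subtype_val, ?_⟩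
  ext v
  constructor
  · intro hv
    have hv0 : v ≠ 0 := by
      rintro rfl
      have : α * ‖(0 : Space m n).fst‖ < ‖(0 : Space m n).snd‖ := hv
      simp at this
    have hn0 : 0 < ‖v‖ := norm_pos_iff.2 hv0
    refine ⟨‖v‖, hn0, ⟨‖v‖⁻¹ • v, ?_⟩, ?_, ?_⟩
    · rw [mem_sphere_zero_iff_norm, norm_smul, norm_inv, norm_norm, inv_mul_cancel₀ hn0.ne']
    · exact (hsmul _ _ (inv_pos.2 hn0)).2 hv
    · rw [smul_inv_smul₀ hn0.ne']
  · rintro ⟨t, ht, x, hx, rfl⟩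
    exact (hsmul t _ ht).2 hx

/-- Squaring both sides of |z| > α|y| gives a globally smooth function, so the neighbourhood {0}ᶜ
serves all points at once. -/
theorem hasSmoothBoundaryAt_solidLawsonCone (hn : 1 ≤ n) {α : ℝ} (hα : 0 < α) {p : Space m n}
    (hp : p ≠ 0) : HasSmoothBoundaryAt (solidLawsonCone m n α) p := by
  have hsq : ∀ x : Space m n, ‖x.snd‖ ^ 2 - α ^ 2 * ‖x.fst‖ ^ 2 =
      ‖x.snd‖ ^ 2 - (α * ‖x.fst‖) ^ 2 := fun x => by ring
  have hnn : ∀ x : Space m n, 0 ≤ α * ‖x.fst‖ := fun x => mul_nonneg hα.le (norm_nonneg _)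
  refine ⟨{0}ᶜ, fun x => ‖x.snd‖ ^ 2 - α ^ 2 * ‖x.fst‖ ^ 2, isOpen_compl_singleton, hp, ?_, ?_,
    ?_, ?_⟩
  · exact (contDiff_quadratic α).contDiffOn
  · exact fun x hx => fderiv_quadratic_ne_zero hα hx
  · ext x
    change (α * ‖x.fst‖ < ‖x.snd‖ ∧ x ∈ ({0}ᶜ : Set (Space m n))) ↔
      (x ∈ ({0}ᶜ : Set (Space m n)) ∧ 0 < ‖x.snd‖ ^ 2 - α ^ 2 * ‖x.fst‖ ^ 2)
    rw [and_comm, hsq, sub_pos, sq_lt_sq₀ (hnn x) (norm_nonneg _)]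
  · rw [frontier_solidLawsonCone hn α]
    ext x
    change (‖x.snd‖ = α * ‖x.fst‖ ∧ x ∈ ({0}ᶜ : Set (Space m n))) ↔
      (x ∈ ({0}ᶜ : Set (Space m n)) ∧ ‖x.snd‖ ^ 2 - α ^ 2 * ‖x.fst‖ ^ 2 = 0)
    rw [and_comm, hsq, sub_eq_zero, sq_eq_sq₀ (norm_nonneg _) (hnn x)]

theorem solidLawsonCone_tan {θ : ℝ} (hθ : 0 < Real.cos θ) :
    solidLawsonCone m n (Real.tan θ) = {x | 0 < coneFun θ x} := by
  ext x
  change Real.tan θ * ‖x.fst‖ < ‖x.snd‖ ↔ 0 < Real.cos θ * ‖x.snd‖ - Real.sin θ * ‖x.fst‖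
  rw [sub_pos, Real.tan_eq_sin_div_cos, div_mul_eq_mul_div, div_lt_iff₀ hθ, mul_comm ‖x.snd‖]

theorem isNonlocalMinimalCone_tan_iff (hn : 1 ≤ n) {s : ℝ} (hs0 : 0 < s) (hs1 : s < 1)
    {e : EuclideanSpace ℝ (Fin m)} {f : EuclideanSpace ℝ (Fin n)} (he : ‖e‖ = 1) (hf : ‖f‖ = 1)
    {θ : ℝ} (hθ : θ ∈ Ioo 0 (Real.pi / 2)) :
    IsNonlocalMinimalCone s (solidLawsonCone m n (Real.tan θ)) ↔
      curv s (tiltedCone e f θ) = 0 := by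
  obtain ⟨hsin, hcos⟩ := sin_cos_pos hθ
  have htan : 0 < Real.tan θ := Real.tan_pos_of_pos_of_lt_pi_div_two hθ.1 hθ.2
  constructor
  · rintro ⟨-, h⟩
    rw [← hasNonlocalMeanCurvature_cone_iff hs0 hs1 he hf hθ one_pos, ← solidLawsonCone_tan hcos]
    refine (h _ ⟨?_, ?_⟩).2
    · rw [frontier_solidLawsonCone hn _, one_smul]
      change ‖Real.sin θ • f‖ = Real.tan θ * ‖Real.cos θ • e‖
      rw [norm_smul, norm_smul, he, hf, Real.norm_of_nonneg hsin.le, Real.norm_of_nonneg hcos.le,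
        mul_one, mul_one, Real.tan_mul_cos hcos.ne']
    · intro h0
      have h1 : Real.sin θ • f = 0 := by
        simpa using congrArg WithLp.snd (show _ = (0 : Space m n) from h0)
      have := congrArg norm h1
      rw [norm_smul, hf, norm_zero, mul_one, norm_eq_zero] at this
      exact hsin.ne' this
  · intro h
    refine ⟨isSolidCone_solidLawsonCone m n _, ?_⟩
    rintro p ⟨hp, hp0⟩
    refine ⟨hasSmoothBoundaryAt_solidLawsonCone hn htan hp0, ?_⟩
    rw [frontier_solidLawsonCone hn _] at hp
    have hp1 : ‖p.snd‖ = Real.tan θ * ‖p.fst‖ := hp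
    have hy : 0 < ‖p.fst‖ := by
      refine lt_of_le_of_ne (norm_nonneg _) fun hy => hp0 ?_
      have := WithLp.prod_norm_sq_eq_of_L2 p
      rw [hp1, ← hy] at this
      simpa using this
    have hz : 0 < ‖p.snd‖ := by rw [hp1]; exact mul_pos htan hy
    have hr : 0 < ‖p.fst‖ / Real.cos θ := div_pos hy hcos
    -- The frame is adapted to p: the unit vectors are y/|y| and z/|z|, and |y|/cos θ is the
    -- distance of p from the vertex.
    have hpe : p = (‖p.fst‖ / Real.cos θ) • WithLp.toLp 2
        (Real.cos θ • (‖p.fst‖⁻¹ • p.fst), Real.sin θ • (‖p.snd‖⁻¹ • p.snd)) := by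
      have e1 : ‖p.fst‖ / Real.cos θ * (Real.cos θ * ‖p.fst‖⁻¹) = 1 := by field_simp
      have e2 : ‖p.fst‖ / Real.cos θ * (Real.sin θ * ‖p.snd‖⁻¹) = 1 := by
        rw [hp1, Real.tan_eq_sin_div_cos]; field_simp
      refine (WithLp.ofLp_injective 2) (Prod.ext ?_ ?_)
      · change p.fst = (‖p.fst‖ / Real.cos θ) • Real.cos θ • (‖p.fst‖⁻¹ • p.fst)
        rw [smul_smul, smul_smul, mul_assoc, e1, one_smul]
      · change p.snd = (‖p.fst‖ / Real.cos θ) • Real.sin θ • (‖p.snd‖⁻¹ • p.snd)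
        rw [smul_smul, smul_smul, mul_assoc, e2, one_smul]
    have he' : ‖‖p.fst‖⁻¹ • p.fst‖ = 1 := by
      rw [norm_smul, norm_inv, norm_norm, inv_mul_cancel₀ hy.ne']
    have hf' : ‖‖p.snd‖⁻¹ • p.snd‖ = 1 := by
      rw [norm_smul, norm_inv, norm_norm, inv_mul_cancel₀ hz.ne']
    rw [hpe, solidLawsonCone_tan hcos, hasNonlocalMeanCurvature_cone_iff hs0 hs1 he' hf' hθ hr]
    exact (curv_tiltedCone_eq_zero_iff hs0 hs1 he hf he' hf' hθ).1 h

end Lawson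

end NonlocalMinimal

end

theorem theorem1 (m n : ℕ) (hm : 1 ≤ m) (hn : 1 ≤ n) (s : ℝ) (hs0 : 0 < s) (hs1 : s < 1) :
    (∀ α : ℝ, 0 < α → frontier (NonlocalMinimal.solidLawsonCone m n α) =
        NonlocalMinimal.lawsonCone m n α) ∧
      ∃! α : ℝ, 0 < α ∧
        NonlocalMinimal.IsNonlocalMinimalCone s (NonlocalMinimal.solidLawsonCone m n α) := by
  refine ⟨fun α _ => NonlocalMinimal.frontier_solidLawsonCone hn α, ?_⟩
  have he : ‖EuclideanSpace.single (⟨0, hm⟩ : Fin m) (1 : ℝ)‖ = 1 := by simp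
  have hf : ‖EuclideanSpace.single (⟨0, hn⟩ : Fin n) (1 : ℝ)‖ = 1 := by simp
  have : Nontrivial (EuclideanSpace ℝ (Fin m)) :=
    ⟨_, 0, ne_zero_of_norm_ne_zero (he.trans_ne one_ne_zero)⟩
  have : Nontrivial (EuclideanSpace ℝ (Fin n)) :=
    ⟨_, 0, ne_zero_of_norm_ne_zero (hf.trans_ne one_ne_zero)⟩
  obtain ⟨θ, ⟨hθ, h⟩, huniq⟩ :=
    NonlocalMinimal.existsUnique_curv_tiltedCone_eq_zero hs0 hs1 he hf
  refine ⟨Real.tan θ, ⟨Real.tan_pos_of_pos_of_lt_pi_div_two hθ.1 hθ.2,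
    (NonlocalMinimal.isNonlocalMinimalCone_tan_iff hn hs0 hs1 he hf hθ).2 h⟩, ?_⟩
  rintro β ⟨hβ, hβ'⟩
  have hmem : Real.arctan β ∈ Ioo 0 (Real.pi / 2) :=
    ⟨Real.arctan_pos.2 hβ, Real.arctan_lt_pi_div_two β⟩
  rw [← Real.tan_arctan β] at hβ' ⊢
  rw [huniq _ ⟨hmem, (NonlocalMinimal.isNonlocalMinimalCone_tan_iff hn hs0 hs1 he hf hmem).1 hβ'⟩]
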